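/- Let $(M,J,g)$ be a compact connected almost Hermitian manifold and let $(\tilde M,\tilde J,\tilde g)$ be an almost Hermitian manifold; that is, $M,\tilde M$ are smooth manifolds without boundary, $J,\tilde J$ are smooth almost complex structures, and $g,\tilde g$ are smooth Riemannian metrics with $g(JX,JY)=g(X,Y)$ and $\tilde g(\tilde JX,\tilde JY)=\tilde g(X,Y)$. Let $\nabla$ be the canonical connection of $(M,J,g)$, i.e. the unique affine connection with $\nabla g=0$, $\nabla J=0$ whose torsion $\tau(X,Y)=\nabla_XY-\nabla_YX-[X,Y]$ has vanishing $(1,1)$-part (equivalently, $\tau(X,Y)+\tau(JX,JY)=0$), let $R(X,Y)Z=\nabla_X\nabla_YZ-\nabla_Y\nabla_XZ-\nabla_{[X,Y]}Z$ be its curvature, and let the holomorphic sectional curvature in the direction of a tangent vector $v\neq 0$ be $$H(v)=\frac{g(R(v,Jv)Jv,v)}{g(v,v)^2},$$ which equals $g(R(\xi,\bar\xi)\xi,\bar\xi)/g(\xi,\bar\xi)^2$ for the $(1,0)$-vector $\xi=v-\sqrt{-1}\,Jv$, with $g$ and $R$ extended complex multilinearly. Define $\tilde H$ for $(\tilde M,\tilde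 J,\tilde g)$ in the same way. Suppose that either 1. $H(v)\ge 0$ for all nonzero tangent vectors $v$ of $M$ and $\tilde H(w)<0$ for all nonzero tangent vectors $w$ of $\tilde M$, or 2. $H(v)>0$ for all nonzero tangent vectors $v$ of $M$ and $\tilde H(w)\le 0$ for all nonzero tangent vectors $w$ of $\tilde M$. Then every almost holomorphic map $f:M\to\tilde M$, i.e. every smooth map with $df\circ J=\tilde J\circ df$, is constant. -/

import Mathlib

open scoped Manifold ContDiff

/-- An almost Hermitian structure on a smooth manifold `M` modelled on `E`: a smooth Riemannian
metric `g` together with a smooth almost complex structure `J` such that `g (J u) (J v) = g u v`. -/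
structure AlmostHermitianStructure (E : Type*) [NormedAddCommGroup E] [NormedSpace ℝ E]
    (M : Type*) [TopologicalSpace M] [ChartedSpace E M] [IsManifold 𝓘(ℝ, E) ∞ M] where
  /-- the smooth Riemannian metric -/
  g : Bundle.ContMDiffRiemannianMetric 𝓘(ℝ, E) ∞ E (fun x : M ↦ TangentSpace 𝓘(ℝ, E) x)
  /-- the almost complex structure -/
  J : ∀ x : M, TangentSpace 𝓘(ℝ, E) x →L[ℝ] TangentSpace 𝓘(ℝ, E) x
  contMDiff_J : ContMDiff 𝓘(ℝ, E) (𝓘(ℝ, E).prod 𝓘(ℝ, E →L[ℝ] E)) ∞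
    (fun x : M ↦ Bundle.TotalSpace.mk' (E →L[ℝ] E)
      (E := fun x : M ↦ TangentSpace 𝓘(ℝ, E) x →L[ℝ] TangentSpace 𝓘(ℝ, E) x) x (J x))
  J_J : ∀ (x : M) (v : TangentSpace 𝓘(ℝ, E) x), J x (J x v) = -v
  g_J_J : ∀ (x : M) (v w : TangentSpace 𝓘(ℝ, E) x),
    g.inner x (J x v) (J x w) = g.inner x v w

namespace AlmostHermitianStructure

open Bundle VectorField

variable {E : Type*} [NormedAddCommGroup E] [NormedSpace ℝ E]
  {M : Type*} [TopologicalSpace M] [ChartedSpace E M] [IsManifold 𝓘(ℝ, E) ∞ M]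
  (h : AlmostHermitianStructure E M)

/-- The vector field `J X`. -/
noncomputable def JField (X : Π x : M, TangentSpace 𝓘(ℝ, E) x) : Π x : M, TangentSpace 𝓘(ℝ, E) x :=
  fun x ↦ h.J x (X x)

/-- The function `g (X, Y)`. -/
noncomputable def gField (X Y : Π x : M, TangentSpace 𝓘(ℝ, E) x) : M → ℝ :=
  fun x ↦ h.g.inner x (X x) (Y x)

section
variable {h}
variable {X Y W X' : Π x : M, TangentSpace 𝓘(ℝ, E) x} {x : M}

theorem mdifferentiableAt_JField (hX : MDiffAt (T% X) x) : MDiffAt (T% (h.JField X)) x :=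
  (h.contMDiff_J.contMDiffAt.mdifferentiableAt (by simp)).clm_bundle_apply hX

theorem mdifferentiableAt_gField (hX : MDiffAt (T% X) x) (hY : MDiffAt (T% Y) x) :
    MDiffAt (h.gField X Y) x := by
  have := (h.g.contMDiff.contMDiffAt (x := x) |>.mdifferentiableAt (by simp)).clm_bundle_apply₂
    (E₃ := Bundle.Trivial M ℝ) (F₃ := ℝ) hX hY
  simp only [mdifferentiableAt_totalSpace] at this
  exact this.2

end

/-- The almost Hermitian connections with vanishing `(1,1)`-torsion: `∇ g = 0`, `∇ J = 0`, and
`τ(u, v) + τ(J u, J v) = 0`, the left-hand side being twice the `(1,1)`-part of the torsion `τ`.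
In Mathlib's convention `∇ Y x v` is the derivative of the field `Y` at `x` in the direction `v`. -/
structure IsCanonicalConnection [FiniteDimensional ℝ E]
    (cov : CovariantDerivative 𝓘(ℝ, E) E (fun x : M ↦ TangentSpace 𝓘(ℝ, E) x)) : Prop where
  metric : ∀ (Y Z : Π x : M, TangentSpace 𝓘(ℝ, E) x) (x : M), MDiffAt (T% Y) x →
    MDiffAt (T% Z) x → ∀ v : TangentSpace 𝓘(ℝ, E) x,
      mvfderiv 𝓘(ℝ, E) (h.gField Y Z) x v =
        h.g.inner x (cov Y x v) (Z x) + h.g.inner x (Y x) (cov Z x v)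
  complex : ∀ (Y : Π x : M, TangentSpace 𝓘(ℝ, E) x) (x : M), MDiffAt (T% Y) x →
    ∀ v : TangentSpace 𝓘(ℝ, E) x, cov (h.JField Y) x v = h.J x (cov Y x v)
  torsion : ∀ (x : M) (u v : TangentSpace 𝓘(ℝ, E) x),
    cov.torsion x u v + cov.torsion x (h.J x u) (h.J x v) = 0

/-! ### Existence and uniqueness of the canonical connection -/

section construction

variable {h}
variable {X Y W X' : Π x : M, TangentSpace 𝓘(ℝ, E) x} {x : M}

theorem JField_smul (f : M → ℝ) (X : Π x : M, TangentSpace 𝓘(ℝ, E) x) :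
    h.JField (f • X) = f • h.JField X := by
  ext x; simp [JField]

theorem JField_add (X X' : Π x : M, TangentSpace 𝓘(ℝ, E) x) :
    h.JField (X + X') = h.JField X + h.JField X' := by
  ext x; simp [JField]

theorem JField_JField (X : Π x : M, TangentSpace 𝓘(ℝ, E) x) :
    h.JField (h.JField X) = -X := by
  ext x; simp [JField, h.J_J]

theorem g_J_left (x : M) (u v : TangentSpace 𝓘(ℝ, E) x) :
    h.g.inner x (h.J x u) v = -h.g.inner x u (h.J x v) := by
  rw [← h.g_J_J x u (h.J x v), h.J_J]; simp

variable (h) in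
/-- The real form of `(X, Y) ↦ [X^{0,1}, Y^{1,0}]^{1,0}`. -/
noncomputable def dbarField (X Y : Π x : M, TangentSpace 𝓘(ℝ, E) x) :
    Π x : M, TangentSpace 𝓘(ℝ, E) x := fun x ↦
  (4⁻¹ : ℝ) • (mlieBracket 𝓘(ℝ, E) X Y x + mlieBracket 𝓘(ℝ, E) (h.JField X) (h.JField Y) x
    + h.J x (mlieBracket 𝓘(ℝ, E) (h.JField X) Y x - mlieBracket 𝓘(ℝ, E) X (h.JField Y) x))

variable (h) in
/-- The value of `g (∇_X Y, W)` for the canonical connection `∇`. -/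
noncomputable def connForm (Y X W : Π x : M, TangentSpace 𝓘(ℝ, E) x) (x : M) : ℝ :=
  h.g.inner x (h.dbarField X Y x) (W x) - h.g.inner x (Y x) (h.dbarField X W x)
    + 2⁻¹ * (mvfderiv 𝓘(ℝ, E) (h.gField Y W) x (X x)
      - mvfderiv 𝓘(ℝ, E) (h.gField (h.JField Y) W) x (h.J x (X x)))

theorem gField_smul_left (f : M → ℝ) : h.gField (f • Y) W = fun x ↦ f x * h.gField Y W x := by
  ext x; simp [gField]

theorem gField_smul_right (f : M → ℝ) : h.gField Y (f • W) = fun x ↦ f x * h.gField Y W x := by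
  ext x; simp [gField]

theorem gField_add_left : h.gField (X + X') W = fun x ↦ h.gField X W x + h.gField X' W x := by
  ext x; simp [gField]

theorem gField_add_right : h.gField W (X + X') = fun x ↦ h.gField W X x + h.gField W X' x := by
  ext x; simp [gField]

theorem g_ext {u u' : TangentSpace 𝓘(ℝ, E) x}
    (hu : ∀ w, h.g.inner x u w = h.g.inner x u' w) : u = u' := by
  by_contra hne
  have := h.g.pos x (u - u') (sub_ne_zero.2 hne)
  simp [hu] at this

theorem connForm_metric :
    h.connForm Y X W x + h.connForm W X Y x = mvfderiv 𝓘(ℝ, E) (h.gField Y W) x (X x) := by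
  have e1 : h.gField W Y = h.gField Y W := by ext y; exact h.g.symm y _ _
  have e2 : h.gField (h.JField W) Y = -h.gField (h.JField Y) W := by
    ext y; simp only [gField, JField, Pi.neg_apply, g_J_left]; rw [h.g.symm, g_J_left]
  simp only [connForm, e1, e2, mvfderiv_neg, h.g.symm x (W x)]
  simp [h.g.symm x (Y x)]
  ring

variable [FiniteDimensional ℝ E]

theorem dbarField_smul_left {f : M → ℝ} (hf : MDiffAt f x) (hX : MDiffAt (T% X) x) :
    h.dbarField (f • X) Y x = f x • h.dbarField X Y x := by
  have hJX := mdifferentiableAt_JField (h := h) hX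
  simp only [dbarField, JField_smul, mlieBracket_smul_left hf hX, mlieBracket_smul_left hf hJX,
    map_add, map_sub, map_smul, map_neg, neg_smul]
  simp only [JField, h.J_J]
  module

theorem dbarField_add_left (hX : MDiffAt (T% X) x) (hX' : MDiffAt (T% X') x) :
    h.dbarField (X + X') Y x = h.dbarField X Y x + h.dbarField X' Y x := by
  have hJX := mdifferentiableAt_JField (h := h) hX
  have hJX' := mdifferentiableAt_JField (h := h) hX'
  simp only [dbarField, JField_add, mlieBracket_add_left hX hX', mlieBracket_add_left hJX hJX',
    map_add, map_sub]
  module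

theorem dbarField_smul_right {f : M → ℝ} (hf : MDiffAt f x) (hY : MDiffAt (T% Y) x) :
    h.dbarField X (f • Y) x = f x • h.dbarField X Y x
      + (2⁻¹ : ℝ) • (mvfderiv 𝓘(ℝ, E) f x (X x) • Y x
        + mvfderiv 𝓘(ℝ, E) f x (h.J x (X x)) • h.J x (Y x)) := by
  have hJY := mdifferentiableAt_JField (h := h) hY
  simp only [dbarField, JField_smul, mlieBracket_smul_right hf hY, mlieBracket_smul_right hf hJY,
    map_add, map_sub, map_smul]
  simp only [JField, h.J_J]
  module

theorem dbarField_add_right (hX : MDiffAt (T% X) x) (hX' : MDiffAt (T% X') x) :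
    h.dbarField Y (X + X') x = h.dbarField Y X x + h.dbarField Y X' x := by
  have hJX := mdifferentiableAt_JField (h := h) hX
  have hJX' := mdifferentiableAt_JField (h := h) hX'
  simp only [dbarField, JField_add, mlieBracket_add_right hX hX', mlieBracket_add_right hJX hJX',
    map_add, map_sub]
  module

theorem mlieBracket_neg_left' (hX : MDiffAt (T% X) x) :
    mlieBracket 𝓘(ℝ, E) (-X) Y x = -mlieBracket 𝓘(ℝ, E) X Y x := by
  have e : -X = (fun _ : M ↦ (-1 : ℝ)) • X := by ext y; simp
  rw [e, mlieBracket_smul_left mdifferentiableAt_const hX, mvfderiv_const]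
  simp

theorem mlieBracket_neg_right' (hX : MDiffAt (T% X) x) :
    mlieBracket 𝓘(ℝ, E) Y (-X) x = -mlieBracket 𝓘(ℝ, E) Y X x := by
  rw [mlieBracket_swap_apply, mlieBracket_neg_left' hX, mlieBracket_swap_apply (V := Y)]

theorem dbarField_J_left (hX : MDiffAt (T% X) x) :
    h.dbarField (h.JField X) Y x = -h.J x (h.dbarField X Y x) := by
  simp only [dbarField, JField_JField, map_smul, map_add, map_sub, h.J_J,
    mlieBracket_neg_left' hX]
  simp only [map_neg]
  module

theorem dbarField_J_right (hY : MDiffAt (T% Y) x) :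
    h.dbarField X (h.JField Y) x = h.J x (h.dbarField X Y x) := by
  simp only [dbarField, JField_JField, map_smul, map_add, map_sub, h.J_J,
    mlieBracket_neg_right' hY]
  simp only [map_neg]
  module

theorem connForm_tensorial_left :
    TensorialAt 𝓘(ℝ, E) E (fun X : Π x : M, TangentSpace 𝓘(ℝ, E) x ↦ h.connForm Y X W x) x where
  smul hf hX := by
    simp only [connForm, dbarField_smul_left hf hX]
    simp
    ring
  add hX hX' := by
    simp only [connForm, dbarField_add_left hX hX']
    simp
    ring

theorem connForm_tensorial_right (hY : MDiffAt (T% Y) x) :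
    TensorialAt 𝓘(ℝ, E) E (fun W : Π x : M, TangentSpace 𝓘(ℝ, E) x ↦ h.connForm Y X W x) x where
  smul {f W} hf hW := by
    have hJY := mdifferentiableAt_JField (h := h) hY
    simp only [connForm, dbarField_smul_right hf hW, gField_smul_right,
      mvfderiv_fun_mul hf (mdifferentiableAt_gField (h := h) hY hW),
      mvfderiv_fun_mul hf (mdifferentiableAt_gField (h := h) hJY hW)]
    simp [gField, JField, g_J_left]
    ring
  add hW hW' := by
    have hJY := mdifferentiableAt_JField (h := h) hY
    simp only [connForm, dbarField_add_right hW hW', gField_add_right,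
      mvfderiv_fun_add (mdifferentiableAt_gField (h := h) hY hW)
        (mdifferentiableAt_gField (h := h) hY hW'),
      mvfderiv_fun_add (mdifferentiableAt_gField (h := h) hJY hW)
        (mdifferentiableAt_gField (h := h) hJY hW')]
    simp
    ring

theorem connForm_add (hY : MDiffAt (T% Y) x) (hX : MDiffAt (T% X') x) (hW : MDiffAt (T% W) x) :
    h.connForm (Y + X') X W x = h.connForm Y X W x + h.connForm X' X W x := by
  have hJY := mdifferentiableAt_JField (h := h) hY
  have hJX := mdifferentiableAt_JField (h := h) hX
  simp only [connForm, dbarField_add_right hY hX, JField_add, gField_add_left,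
      mvfderiv_fun_add (mdifferentiableAt_gField (h := h) hY hW)
        (mdifferentiableAt_gField (h := h) hX hW),
      mvfderiv_fun_add (mdifferentiableAt_gField (h := h) hJY hW)
        (mdifferentiableAt_gField (h := h) hJX hW)]
  simp
  ring

theorem connForm_smul {f : M → ℝ} (hf : MDiffAt f x) (hY : MDiffAt (T% Y) x)
    (hW : MDiffAt (T% W) x) :
    h.connForm (f • Y) X W x
      = f x * h.connForm Y X W x + mvfderiv 𝓘(ℝ, E) f x (X x) * h.g.inner x (Y x) (W x) := by
  have hJY := mdifferentiableAt_JField (h := h) hY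
  simp only [connForm, dbarField_smul_right hf hY, JField_smul, gField_smul_left,
      mvfderiv_fun_mul hf (mdifferentiableAt_gField (h := h) hY hW),
      mvfderiv_fun_mul hf (mdifferentiableAt_gField (h := h) hJY hW)]
  simp [gField, JField]
  ring

theorem connForm_complex (hY : MDiffAt (T% Y) x) (hW : MDiffAt (T% W) x) :
    h.connForm (h.JField Y) X W x = -h.connForm Y X (h.JField W) x := by
  have e1 : h.gField (h.JField Y) (h.JField W) = h.gField Y W := by ext y; exact h.g_J_J y _ _
  have e2 : h.gField Y (h.JField W) = -h.gField (h.JField Y) W := by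
    ext y; simp only [gField, JField, Pi.neg_apply, g_J_left]; simp
  have e3 : h.gField (h.JField (h.JField Y)) W = -h.gField Y W := by
    ext y; simp [JField_JField, gField]
  simp only [connForm, dbarField_J_right hY, dbarField_J_right hW, e1, e2, e3, mvfderiv_neg]
  simp [JField, g_J_left]
  ring

theorem connForm_J (hX : MDiffAt (T% X) x) (hW : MDiffAt (T% W) x) :
    h.connForm Y X W x - h.connForm Y (h.JField X) (h.JField W) x =
      2 * h.g.inner x (h.dbarField X Y x) (W x) := by
  have e1 : h.gField (h.JField Y) (h.JField W) = h.gField Y W := by ext y; exact h.g_J_J y _ _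
  have e2 : h.gField Y (h.JField W) = -h.gField (h.JField Y) W := by
    ext y; simp only [gField, JField, Pi.neg_apply, g_J_left]; simp
  simp only [connForm, dbarField_J_left hX, dbarField_J_right hW, e1, e2, mvfderiv_neg]
  simp [JField, g_J_left, h.J_J]
  ring

variable (h) in
theorem exists_sharp (x : M) :
    ∃ S : (TangentSpace 𝓘(ℝ, E) x →L[ℝ] ℝ) →L[ℝ] TangentSpace 𝓘(ℝ, E) x,
      ∀ φ w, h.g.inner x (S φ) w = φ w := by
  have : FiniteDimensional ℝ (TangentSpace 𝓘(ℝ, E) x) := inferInstanceAs (FiniteDimensional ℝ E)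
  have : T2Space (TangentSpace 𝓘(ℝ, E) x) := inferInstanceAs (T2Space E)
  let D : (TangentSpace 𝓘(ℝ, E) x →ₗ[ℝ] ℝ) ≃ₗ[ℝ] (TangentSpace 𝓘(ℝ, E) x →L[ℝ] ℝ) :=
    LinearMap.toContinuousLinearMap
  have : FiniteDimensional ℝ (TangentSpace 𝓘(ℝ, E) x →L[ℝ] ℝ) := D.finiteDimensional
  have hr : Module.finrank ℝ (TangentSpace 𝓘(ℝ, E) x)
      = Module.finrank ℝ (TangentSpace 𝓘(ℝ, E) x →L[ℝ] ℝ) := by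
    rw [← D.finrank_eq]; exact (Subspace.dual_finrank_eq).symm
  have hi : Function.Injective (h.g.inner x).toLinearMap := by
    intro u u' huu
    exact g_ext (h := h) fun w ↦ congrArg (fun φ : TangentSpace 𝓘(ℝ, E) x →L[ℝ] ℝ ↦ φ w) huu
  let e := LinearMap.linearEquivOfInjective _ hi hr
  refine ⟨⟨e.symm.toLinearMap, LinearMap.continuous_of_finiteDimensional _⟩, fun φ w ↦ ?_⟩
  exact congrArg (fun φ : TangentSpace 𝓘(ℝ, E) x →L[ℝ] ℝ ↦ φ w) (e.apply_symm_apply φ)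

theorem IsCanonicalConnection.g_apply
    {cov : CovariantDerivative 𝓘(ℝ, E) E (fun x : M ↦ TangentSpace 𝓘(ℝ, E) x)}
    (hc : h.IsCanonicalConnection cov) (hY : MDiffAt (T% Y) x) (hX : MDiffAt (T% X) x)
    (hW : MDiffAt (T% W) x) :
    h.g.inner x (cov Y x (X x)) (W x) = h.connForm Y X W x := by
  have hJX := mdifferentiableAt_JField (h := h) hX
  have key (Z : Π x : M, TangentSpace 𝓘(ℝ, E) x) (hZ : MDiffAt (T% Z) x) :
      h.dbarField X Z x = (2⁻¹ : ℝ) • (cov Z x (X x) + h.J x (cov Z x (h.J x (X x)))) := by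
    have hJZ := mdifferentiableAt_JField (h := h) hZ
    have t1 := cov.torsion_apply hX hZ
    have t2 := cov.torsion_apply hJX hJZ
    have t3 := cov.torsion_apply hJX hZ
    have t4 := cov.torsion_apply hX hJZ
    have s1 := hc.torsion x (X x) (Z x)
    have s2 := hc.torsion x (X x) (h.J x (Z x))
    rw [hc.complex Z x hZ, hc.complex X x hX] at t2
    rw [hc.complex X x hX] at t3
    rw [hc.complex Z x hZ] at t4
    simp only [JField, h.J_J, map_neg] at t1 t2 t3 t4 s1 s2
    have b1 : mlieBracket 𝓘(ℝ, E) X Z x + mlieBracket 𝓘(ℝ, E) (h.JField X) (h.JField Z) x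
        = cov Z x (X x) - cov X x (Z x) + h.J x (cov Z x (h.J x (X x)))
          - h.J x (cov X x (h.J x (Z x))) := by
      simp only [JField] at *
      linear_combination (norm := module) t1 + t2 - s1
    have b2 : mlieBracket 𝓘(ℝ, E) (h.JField X) Z x - mlieBracket 𝓘(ℝ, E) X (h.JField Z) x
        = cov Z x (h.J x (X x)) - h.J x (cov X x (Z x)) - h.J x (cov Z x (X x))
          + cov X x (h.J x (Z x)) := by
      simp only [JField] at *
      linear_combination (norm := module) t3 - t4 + s2
    rw [dbarField, b1, b2]
    simp only [map_sub, map_add, h.J_J]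
    module
  have m1 := hc.metric Y W x hY hW (X x)
  have m2 := hc.metric (h.JField Y) W x (mdifferentiableAt_JField hY) hW (h.J x (X x))
  rw [hc.complex Y x hY] at m2
  rw [connForm, key Y hY, key W hW, m1, m2]
  simp [JField, g_J_left]
  ring

variable (h) in
theorem exists_isCanonicalConnection :
    ∃ cov : CovariantDerivative 𝓘(ℝ, E) E (fun x : M ↦ TangentSpace 𝓘(ℝ, E) x),
      h.IsCanonicalConnection cov := by
  classical
  choose S hS using h.exists_sharp
  let Φ (Y : Π x : M, TangentSpace 𝓘(ℝ, E) x) (x : M) (hY : MDiffAt (T% Y) x) :=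
    TensorialAt.mkHom₂ (I := 𝓘(ℝ, E)) (F := E) (F' := E) (fun X W ↦ h.connForm Y X W x) x
      (fun _ _ ↦ connForm_tensorial_left) (fun _ _ ↦ connForm_tensorial_right hY)
  have hΦ {Y X W : Π x : M, TangentSpace 𝓘(ℝ, E) x} {x : M} (hY : MDiffAt (T% Y) x)
      (hX : MDiffAt (T% X) x) (hW : MDiffAt (T% W) x) :
      Φ Y x hY (X x) (W x) = h.connForm Y X W x := TensorialAt.mkHom₂_apply _ _ hX hW
  let D (Y : Π x : M, TangentSpace 𝓘(ℝ, E) x) (x : M) :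
      TangentSpace 𝓘(ℝ, E) x →L[ℝ] TangentSpace 𝓘(ℝ, E) x :=
    if hY : MDiffAt (T% Y) x then (S x).comp (Φ Y x hY) else 0
  have hD {Y X W : Π x : M, TangentSpace 𝓘(ℝ, E) x} {x : M} (hY : MDiffAt (T% Y) x)
      (hX : MDiffAt (T% X) x) (hW : MDiffAt (T% W) x) :
      h.g.inner x (D Y x (X x)) (W x) = h.connForm Y X W x := by
    simp only [D, hY, dite_true, ContinuousLinearMap.comp_apply, hS, hΦ hY hX hW]
  have ex {x : M} (v : TangentSpace 𝓘(ℝ, E) x) :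
      ∃ X : Π x : M, TangentSpace 𝓘(ℝ, E) x, MDiffAt (T% X) x ∧ X x = v :=
    ⟨FiberBundle.extend E v, FiberBundle.mdifferentiableAt_extend .., by simp⟩
  let cov : CovariantDerivative 𝓘(ℝ, E) E (fun x : M ↦ TangentSpace 𝓘(ℝ, E) x) :=
    { toFun := D
      isCovariantDerivativeOnUniv :=
        { add := by
            intro Y Y' x hY hY' _
            ext v
            refine g_ext (h := h) fun w ↦ ?_
            obtain ⟨X, hX, rfl⟩ := ex v
            obtain ⟨W, hW, rfl⟩ := ex w
            have hs : MDiffAt (T% (Y + Y')) x := mdifferentiableAt_add_section hY hY'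
            simp [hD hs hX hW, hD hY hX hW, hD hY' hX hW, connForm_add hY hY' hW]
          leibniz := by
            intro Y f x hY hf _
            ext v
            refine g_ext (h := h) fun w ↦ ?_
            obtain ⟨X, hX, rfl⟩ := ex v
            obtain ⟨W, hW, rfl⟩ := ex w
            have hs : MDiffAt (T% (f • Y)) x := hf.smul_section hY
            simp [hD hs hX hW, hD hY hX hW, connForm_smul hf hY hW] } }
  have hcomplex : ∀ (Y : Π x : M, TangentSpace 𝓘(ℝ, E) x) (x : M), MDiffAt (T% Y) x →
      ∀ v : TangentSpace 𝓘(ℝ, E) x, D (h.JField Y) x v = h.J x (D Y x v) := by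
    intro Y x hY v
    refine g_ext (h := h) fun w ↦ ?_
    obtain ⟨X, hX, rfl⟩ := ex v
    obtain ⟨W, hW, rfl⟩ := ex w
    have := hD hY hX (mdifferentiableAt_JField (h := h) hW)
    rw [g_J_left, hD (mdifferentiableAt_JField hY) hX hW, connForm_complex hY hW, ← this]
    rfl
  have hdbar : ∀ (Y X : Π x : M, TangentSpace 𝓘(ℝ, E) x) (x : M), MDiffAt (T% Y) x →
      MDiffAt (T% X) x →
      D Y x (X x) + h.J x (D Y x (h.J x (X x))) = (2 : ℝ) • h.dbarField X Y x := by
    intro Y X x hY hX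
    refine g_ext (h := h) fun w ↦ ?_
    obtain ⟨W, hW, rfl⟩ := ex w
    have h1 := hD hY hX hW
    have h2 := hD hY (mdifferentiableAt_JField (h := h) hX) (mdifferentiableAt_JField (h := h) hW)
    have h3 := connForm_J (h := h) (Y := Y) hX hW
    simp only [map_add, map_smul, add_apply, smul_apply,
      g_J_left, smul_eq_mul]
    rw [← h3, ← h1, ← h2]
    simp [JField]
    ring
  refine ⟨cov, ?_, hcomplex, ?_⟩
  · intro Y Z x hY hZ v
    obtain ⟨X, hX, rfl⟩ := ex v
    change _ = h.g.inner x (D Y x (X x)) (Z x) + h.g.inner x (Y x) (D Z x (X x))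
    rw [hD hY hX hZ, h.g.symm, hD hZ hX hY, connForm_metric]
  · intro x u v
    obtain ⟨X, hX, rfl⟩ := ex u
    obtain ⟨Y, hY, rfl⟩ := ex v
    have hJX := mdifferentiableAt_JField (h := h) hX
    have hJY := mdifferentiableAt_JField (h := h) hY
    have t1 := cov.torsion_apply hX hY
    have t2 := cov.torsion_apply hJX hJY
    change _ = D Y x (X x) - D X x (Y x) - _ at t1
    change _ = D (h.JField Y) x (h.J x (X x)) - D (h.JField X) x (h.J x (Y x)) - _ at t2
    rw [hcomplex Y x hY, hcomplex X x hX] at t2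
    have d1 := hdbar Y X x hY hX
    have d2 := hdbar X Y x hX hY
    have d3 : (2 : ℝ) • h.dbarField X Y x - (2 : ℝ) • h.dbarField Y X x
        = mlieBracket 𝓘(ℝ, E) X Y x + mlieBracket 𝓘(ℝ, E) (h.JField X) (h.JField Y) x := by
      simp only [dbarField]
      rw [mlieBracket_swap_apply (V := Y) (W := X),
        mlieBracket_swap_apply (V := h.JField Y) (W := h.JField X),
        mlieBracket_swap_apply (V := h.JField Y) (W := X),
        mlieBracket_swap_apply (V := Y) (W := h.JField X)]
      simp only [map_sub, map_neg]
      module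
    have t2' : cov.torsion x (h.J x (X x)) (h.J x (Y x)) = _ := t2
    rw [t1, t2']
    linear_combination (norm := module) d1 - d2 + d3

/-- Two canonical connections agree on differentiable vector fields. -/
theorem IsCanonicalConnection.unique
    {cov cov' : CovariantDerivative 𝓘(ℝ, E) E (fun x : M ↦ TangentSpace 𝓘(ℝ, E) x)}
    (hc : h.IsCanonicalConnection cov) (hc' : h.IsCanonicalConnection cov')
    (hY : MDiffAt (T% Y) x) : cov Y x = cov' Y x := by
  ext v
  refine g_ext (h := h) fun w ↦ ?_
  have a := hc.g_apply hY (FiberBundle.mdifferentiableAt_extend 𝓘(ℝ, E) E v)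
    (FiberBundle.mdifferentiableAt_extend 𝓘(ℝ, E) E w)
  have b := hc'.g_apply hY (FiberBundle.mdifferentiableAt_extend 𝓘(ℝ, E) E v)
    (FiberBundle.mdifferentiableAt_extend 𝓘(ℝ, E) E w)
  simpa using a.trans b.symm

end construction

/-! ### Curvature -/

section curvature

variable [FiniteDimensional ℝ E]

/-- The canonical connection of an almost Hermitian manifold (unique on differentiable fields). -/
noncomputable def canonicalConnection :
    CovariantDerivative 𝓘(ℝ, E) E (fun x : M ↦ TangentSpace 𝓘(ℝ, E) x) :=
  Classical.choose h.exists_isCanonicalConnection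

theorem isCanonicalConnection_canonicalConnection :
    h.IsCanonicalConnection h.canonicalConnection :=
  Classical.choose_spec h.exists_isCanonicalConnection

/-- `R(X, Y) Z = ∇_X ∇_Y Z - ∇_Y ∇_X Z - ∇_[X, Y] Z` for the canonical connection `∇`. -/
noncomputable def curvatureField (X Y Z : Π x : M, TangentSpace 𝓘(ℝ, E) x) :
    Π x : M, TangentSpace 𝓘(ℝ, E) x := fun x ↦
  h.canonicalConnection (fun y ↦ h.canonicalConnection Z y (Y y)) x (X x)
    - h.canonicalConnection (fun y ↦ h.canonicalConnection Z y (X y)) x (Y x)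
    - h.canonicalConnection Z x (mlieBracket 𝓘(ℝ, E) X Y x)

/-- The curvature tensor `R(u, v) w` at `x`, computed with extensions of `u`, `v`, `w` to vector
fields that are smooth near `x`. -/
noncomputable def curvature (x : M) (u v w : TangentSpace 𝓘(ℝ, E) x) : TangentSpace 𝓘(ℝ, E) x :=
  h.curvatureField (FiberBundle.extend E u) (FiberBundle.extend E v) (FiberBundle.extend E w) x

/-- The holomorphic sectional curvature `g (R(v, J v) J v, v) / g (v, v) ^ 2` in the direction of
the real tangent vector `v ≠ 0`. It equals `g (R(ξ, ξ̄) ξ, ξ̄) / g (ξ, ξ̄) ^ 2` for the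
`(1,0)`-vector `ξ = v - i J v` and the complex multilinear extensions of `g` and `R`. -/
noncomputable def holomorphicSectionalCurvature (x : M) (v : TangentSpace 𝓘(ℝ, E) x) : ℝ :=
  h.g.inner x (h.curvature x v (h.J x v) (h.J x v)) v / h.g.inner x v v ^ 2

/-- Nonnegative holomorphic sectional curvature. -/
def HasNonnegHSC : Prop :=
  ∀ (x : M) (v : TangentSpace 𝓘(ℝ, E) x), v ≠ 0 → 0 ≤ h.holomorphicSectionalCurvature x v

/-- Positive holomorphic sectional curvature. -/
def HasPosHSC : Prop :=
  ∀ (x : M) (v : TangentSpace 𝓘(ℝ, E) x), v ≠ 0 → 0 < h.holomorphicSectionalCurvature x v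

/-- Nonpositive holomorphic sectional curvature. -/
def HasNonposHSC : Prop :=
  ∀ (x : M) (v : TangentSpace 𝓘(ℝ, E) x), v ≠ 0 → h.holomorphicSectionalCurvature x v ≤ 0

/-- Negative holomorphic sectional curvature. -/
def HasNegHSC : Prop :=
  ∀ (x : M) (v : TangentSpace 𝓘(ℝ, E) x), v ≠ 0 → h.holomorphicSectionalCurvature x v < 0

end curvature

/-- A smooth map `f` is almost holomorphic if `df ∘ J = J' ∘ df`. -/
def IsAlmostHolomorphic {E' : Type*} [NormedAddCommGroup E'] [NormedSpace ℝ E']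
    {N : Type*} [TopologicalSpace N] [ChartedSpace E' N] [IsManifold 𝓘(ℝ, E') ∞ N]
    (h' : AlmostHermitianStructure E' N) (f : M → N) : Prop :=
  ContMDiff 𝓘(ℝ, E) 𝓘(ℝ, E') ∞ f ∧
    ∀ (x : M) (v : TangentSpace 𝓘(ℝ, E) x),
      mfderiv 𝓘(ℝ, E) 𝓘(ℝ, E') f x (h.J x v) = h'.J (f x) (mfderiv 𝓘(ℝ, E) 𝓘(ℝ, E') f x v)

end AlmostHermitianStructure

/-! The proof is a maximum principle for the largest value `l` of `|df v|² / |v|²` over nonzero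
tangent vectors `v`, which is attained because `M` is compact. If `df` is not zero, then `l > 0`. At
a maximizing `v`, with `w = df v ≠ 0`, the main estimate `curv_le_of_isMax` gives `l g(R(v, Jv)Jv,
v) ≤ g'(R'(w, J'w)J'w, w)`. Each of the two curvature hypotheses contradicts it: the left side is
nonnegative and the right side negative, or positive and nonpositive. So `df = 0`, and `f` is
constant because `M` is connected.

The estimate is proved in charts at the base point `p`. Extend `v` to a field `X` with `∇X = 0` at
`p`; since the `(1,1)`-torsion vanishes, `X` and `JX` commute at `p`. The function `|df X|² - l
|X|²` has a maximum at `p`, so the sum of its second derivatives along `X` and `JX` is nonpositive.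
The Bochner formula `fderiv_fderiv_metric` computes this sum for `|s|²`, where `s` is a section of a
bundle with parallel metric and complex structure. Besides a curvature term and the squares of `∇s`,
it contains only first derivatives of `Z = ∇_X s + J ∇_{JX} s`, a `(0,1)`-derivative of `s`.

The formula is applied to `s = X` and to `s = df X` in the pulled back bundle. By `covD_pullback`,
again a consequence of the torsion condition, the second `Z` is `df` of the first. As `Z` vanishes
at `p`, so do the derivatives there correspond under `df`. The two `Z`-terms then cancel, because
`v` lies in the kernel of the semidefinite form `f^*g' - l g`. What remains is the curvature
comparison, together with the squares of `∇(df X)`, which have the favourable sign. -/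

/-! ### Connections in a trivialized vector bundle -/

namespace TrivialBundle

variable {E : Type*} [NormedAddCommGroup E] [NormedSpace ℝ E]
  {V : Type*} [NormedAddCommGroup V] [NormedSpace ℝ V]

/-- The covariant derivative at `y` of the section `s` in the direction `a`, for the connection
with connection form `A`. -/
noncomputable def covD (A : E → E →L[ℝ] V →L[ℝ] V) (s : E → V) (y a : E) : V :=
  fderiv ℝ s y a + A y a (s y)

/-- The curvature of the connection with connection form `A`. -/
noncomputable def curv (A : E → E →L[ℝ] V →L[ℝ] V) (y a b : E) (σ : V) : V :=
  fderiv ℝ A y a b σ - fderiv ℝ A y b a σ + A y a (A y b σ) - A y b (A y a σ)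

variable {A : E → E →L[ℝ] V →L[ℝ] V} {s t : E → V} {X Y : E → E} {p y : E}

theorem covD_add (hs : DifferentiableAt ℝ s y) (ht : DifferentiableAt ℝ t y) (a : E) :
    covD A (fun z ↦ s z + t z) y a = covD A s y a + covD A t y a := by
  simp only [covD, fderiv_fun_add hs ht, add_apply, map_add]
  abel

theorem covD_congr (h : s =ᶠ[nhds y] t) (a : E) : covD A s y a = covD A t y a := by
  simp only [covD, h.fderiv_eq, h.self_of_nhds]

/-- Here and in `covD_complex`, `hA` is the coordinate form of `∇k = 0`, respectively `∇I = 0`, at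
`y` in the direction `a`. -/
theorem fderiv_metric {k : E → V →L[ℝ] V →L[ℝ] ℝ} {a : E} (hk : DifferentiableAt ℝ k y)
    (hs : DifferentiableAt ℝ s y) (ht : DifferentiableAt ℝ t y)
    (hA : ∀ σ τ, fderiv ℝ k y a σ τ = k y (A y a σ) τ + k y σ (A y a τ)) :
    fderiv ℝ (fun z ↦ k z (s z) (t z)) y a
      = k y (covD A s y a) (t y) + k y (s y) (covD A t y a) := by
  rw [((hk.hasFDerivAt.clm_apply hs.hasFDerivAt).clm_apply ht.hasFDerivAt).fderiv]
  simp [covD, hA]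
  ring

theorem covD_complex {I : E → V →L[ℝ] V} {a : E} (hI : DifferentiableAt ℝ I y)
    (hs : DifferentiableAt ℝ s y)
    (hA : ∀ σ, fderiv ℝ I y a σ = I y (A y a σ) - A y a (I y σ)) :
    covD A (fun z ↦ I z (s z)) y a = I y (covD A s y a) := by
  simp only [covD]
  rw [(hI.hasFDerivAt.clm_apply hs.hasFDerivAt).fderiv]
  simp [hA]
  abel

/-- In this expansion the Hessian of `s` and the sum of the two mixed terms `A (ds)` are symmetric
in `a` and `Y p`. They cancel in `covD_covD_sub`, leaving the curvature and the terms with the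
derivative of `Y`, which assemble to the bracket. -/
theorem covD_covD (hs : ContDiffAt ℝ 2 s p) (hA : DifferentiableAt ℝ A p)
    (hY : DifferentiableAt ℝ Y p) (a : E) :
    covD A (fun z ↦ covD A s z (Y z)) p a = fderiv ℝ (fderiv ℝ s) p a (Y p)
      + fderiv ℝ s p (fderiv ℝ Y p a) + fderiv ℝ A p a (Y p) (s p) + A p (fderiv ℝ Y p a) (s p)
      + A p (Y p) (fderiv ℝ s p a) + A p a (fderiv ℝ s p (Y p)) + A p a (A p (Y p) (s p)) := by
  have h2 : DifferentiableAt ℝ (fderiv ℝ s) p :=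
    (hs.fderiv_right (m := 1) (by norm_num)).differentiableAt (by norm_num)
  have h1 : DifferentiableAt ℝ s p := hs.differentiableAt (by norm_num)
  have := (h2.hasFDerivAt.clm_apply hY.hasFDerivAt).add
    ((hA.hasFDerivAt.clm_apply hY.hasFDerivAt).clm_apply h1.hasFDerivAt)
  simp only [covD]
  rw [HasFDerivAt.fderiv (f := fun z ↦ fderiv ℝ s z (Y z) + A z (Y z) (s z)) this]
  simp
  abel

/-- The Ricci identity. -/
theorem covD_covD_sub (hs : ContDiffAt ℝ 2 s p) (hA : DifferentiableAt ℝ A p)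
    (hX : DifferentiableAt ℝ X p) (hY : DifferentiableAt ℝ Y p) :
    covD A (fun z ↦ covD A s z (Y z)) p (X p) - covD A (fun z ↦ covD A s z (X z)) p (Y p)
      = curv A p (X p) (Y p) (s p) + covD A s p (fderiv ℝ Y p (X p) - fderiv ℝ X p (Y p)) := by
  have hsym : fderiv ℝ (fderiv ℝ s) p (X p) (Y p) = fderiv ℝ (fderiv ℝ s) p (Y p) (X p) :=
    (hs.isSymmSndFDerivAt (by simp)).eq _ _
  rw [covD_covD hs hA hY, covD_covD hs hA hX, hsym]
  simp only [covD, curv, map_sub, sub_apply]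
  abel

theorem differentiableAt_covD (hs : ContDiffAt ℝ 2 s p) (hA : DifferentiableAt ℝ A p)
    (hX : DifferentiableAt ℝ X p) : DifferentiableAt ℝ (fun z ↦ covD A s z (X z)) p := by
  have h2 : DifferentiableAt ℝ (fderiv ℝ s) p :=
    (hs.fderiv_right (m := 1) (by norm_num)).differentiableAt (by norm_num)
  have h1 : DifferentiableAt ℝ s p := hs.differentiableAt (by norm_num)
  exact (h2.clm_apply hX).add ((hA.clm_apply hX).clm_apply h1)

/-- A parallel complex structure commutes with the curvature. -/
theorem curv_complex {I : E → V →L[ℝ] V} {U : Set E} (hU : IsOpen U) (hp : p ∈ U)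
    (hI : ContDiffOn ℝ ∞ I U) (hA : DifferentiableAt ℝ A p)
    (hIA : ∀ y ∈ U, ∀ a σ, fderiv ℝ I y a σ = I y (A y a σ) - A y a (I y σ)) (a b : E) (σ : V) :
    curv A p a b (I p σ) = I p (curv A p a b σ) := by
  have hdI : ∀ y ∈ U, DifferentiableAt ℝ I y := fun y hy ↦
    ((hI y hy).contDiffAt (hU.mem_nhds hy)).differentiableAt (by simp)
  have hs : ContDiffAt ℝ 2 (fun z ↦ I z σ) p :=
    (((hI p hp).contDiffAt (hU.mem_nhds hp)).of_le ENat.LEInfty.out).clm_apply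
      contDiffAt_const
  have hσ : ContDiffAt ℝ 2 (fun _ : E ↦ σ) p := contDiffAt_const
  -- A parallel `I` passes through both covariant derivatives. Comparing the Ricci identities of `I
  -- σ` and of the constant section `σ` then gives the claim.
  have key (a b : E) : covD A (fun z ↦ covD A (fun z ↦ I z σ) z b) p a
      = I p (covD A (fun z ↦ covD A (fun _ ↦ σ) z b) p a) := by
    rw [← covD_complex (hdI p hp) (differentiableAt_covD hσ hA (differentiableAt_const b))
      (hIA p hp a)]
    refine covD_congr ?_ a
    filter_upwards [hU.mem_nhds hp] with z hz
    exact covD_complex (hdI z hz) (differentiableAt_const σ) (hIA z hz b)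
  have h1 := covD_covD_sub (X := fun _ ↦ a) (Y := fun _ ↦ b) hs hA (by simp) (by simp)
  have h2 := covD_covD_sub (X := fun _ ↦ a) (Y := fun _ ↦ b) hσ hA (by simp) (by simp)
  rw [key, key, ← map_sub, h2] at h1
  simpa [covD] using h1.symm

/-- A Bochner formula for the sum of the second derivatives of `k(s, s)` along two vector fields
that commute at `p`. -/
theorem fderiv_fderiv_metric {k : E → V →L[ℝ] V →L[ℝ] ℝ} {I : E → V →L[ℝ] V} {U : Set E}
    (hU : IsOpen U) (hp : p ∈ U) (hA : DifferentiableAt ℝ A p)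
    (hs : ContDiffOn ℝ ∞ s U) (hX : DifferentiableAt ℝ X p) (hY : DifferentiableAt ℝ Y p)
    (hXY : fderiv ℝ Y p (X p) = fderiv ℝ X p (Y p))
    (hI : ContDiffOn ℝ ∞ I U)
    (hIA : ∀ y ∈ U, ∀ a σ, fderiv ℝ I y a σ = I y (A y a σ) - A y a (I y σ))
    (hk : ContDiffOn ℝ ∞ k U) (hks : ∀ σ τ, k p σ τ = k p τ σ)
    (hkA : ∀ y ∈ U, ∀ a σ τ, fderiv ℝ k y a σ τ = k y (A y a σ) τ + k y σ (A y a τ))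
    {Z : E → V} (hZ : ∀ y ∈ U, Z y = covD A s y (X y) + I y (covD A s y (Y y)))
    (hII : ∀ σ, I p (I p σ) = -σ) :
    fderiv ℝ (fun y ↦ fderiv ℝ (fun z ↦ k z (s z) (s z)) y (X y)) p (X p)
      + fderiv ℝ (fun y ↦ fderiv ℝ (fun z ↦ k z (s z) (s z)) y (Y y)) p (Y p)
      = 2 * (k p (covD A Z p (X p) - I p (covD A Z p (Y p))) (s p)
        + k p (covD A s p (X p)) (covD A s p (X p)) + k p (covD A s p (Y p)) (covD A s p (Y p))
        - k p (curv A p (X p) (Y p) (I p (s p))) (s p)) := by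
  have hdI : ∀ y ∈ U, DifferentiableAt ℝ I y := fun y hy ↦
    ((hI y hy).contDiffAt (hU.mem_nhds hy)).differentiableAt (by simp)
  have hdk : ∀ y ∈ U, DifferentiableAt ℝ k y := fun y hy ↦
    ((hk y hy).contDiffAt (hU.mem_nhds hy)).differentiableAt (by simp)
  have hds : ∀ y ∈ U, DifferentiableAt ℝ s y := fun y hy ↦
    ((hs y hy).contDiffAt (hU.mem_nhds hy)).differentiableAt (by simp)
  have hs2 : ContDiffAt ℝ 2 s p :=
    ((hs p hp).contDiffAt (hU.mem_nhds hp)).of_le ENat.LEInfty.out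
  have second (X : E → E) (hX : DifferentiableAt ℝ X p) :
      fderiv ℝ (fun y ↦ fderiv ℝ (fun z ↦ k z (s z) (s z)) y (X y)) p (X p)
        = 2 * (k p (covD A (fun z ↦ covD A s z (X z)) p (X p)) (s p)
          + k p (covD A s p (X p)) (covD A s p (X p))) := by
    have e : (fun y ↦ fderiv ℝ (fun z ↦ k z (s z) (s z)) y (X y)) =ᶠ[nhds p]
        fun y ↦ k y (covD A s y (X y)) (s y) + k y (s y) (covD A s y (X y)) := by
      filter_upwards [hU.mem_nhds hp] with y hy
      exact fderiv_metric (hdk y hy) (hds y hy) (hds y hy) (hkA y hy _)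
    have hd := differentiableAt_covD hs2 hA hX
    rw [e.fderiv_eq, fderiv_fun_add (((hdk p hp).clm_apply hd).clm_apply (hds p hp))
      (((hdk p hp).clm_apply (hds p hp)).clm_apply hd), add_apply,
      fderiv_metric (hdk p hp) hd (hds p hp) (hkA p hp _),
      fderiv_metric (hdk p hp) (hds p hp) hd (hkA p hp _), hks (s p)]
    ring
  have hdX := differentiableAt_covD hs2 hA hX
  have hdY := differentiableAt_covD hs2 hA hY
  -- With `I² = -1`, this turns `∇_X Z - I ∇_Y Z` into `∇_X ∇_X s + ∇_Y ∇_Y s + I (∇_X ∇_Y s - ∇_Y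
  -- ∇_X s)`; the last term is a curvature term since `X` and `Y` commute at `p`.
  have hcZ (a : E) : covD A Z p a = covD A (fun z ↦ covD A s z (X z)) p a
      + I p (covD A (fun z ↦ covD A s z (Y z)) p a) := by
    rw [← covD_complex (hdI p hp) hdY (hIA p hp a), ← covD_add hdX ((hdI p hp).clm_apply hdY)]
    refine covD_congr ?_ a
    filter_upwards [hU.mem_nhds hp] with z hz using hZ z hz
  have hR := covD_covD_sub hs2 hA hX hY
  have e0 : covD A s p (0 : E) = 0 := by simp [covD]
  rw [hXY, sub_self, e0, add_zero] at hR
  rw [second X hX, second Y hY, hcZ, hcZ, curv_complex hU hp hI hA hIA, ← hR]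
  simp only [map_add, map_sub, hII, add_apply, sub_apply, map_neg, neg_apply]
  ring

end TrivialBundle

/-! ### Second derivative test along vector fields -/

section secondDerivativeTest

variable {E : Type*} [NormedAddCommGroup E] [NormedSpace ℝ E]

/-- A positive second derivative would make `a` a local minimum as well, so `f` would be constant
near `a` and its second derivative would be zero. -/
theorem IsLocalMax.deriv_deriv_nonpos {f : ℝ → ℝ} {a : ℝ} (h : IsLocalMax f a)
    (hf : ContinuousAt f a) : deriv (deriv f) a ≤ 0 := by
  by_contra! hpos
  have hmin := isLocalMin_of_deriv_deriv_pos hpos h.deriv_eq_zero hf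
  have heq : f =ᶠ[nhds a] fun _ ↦ f a := by
    filter_upwards [h, hmin] with x h1 h2 using le_antisymm h1 h2
  have h1 : deriv f =ᶠ[nhds a] fun _ ↦ 0 := by
    filter_upwards [heq.eventuallyEq_nhds] with x hx
    rw [hx.deriv_eq, deriv_const]
  rw [h1.deriv_eq, deriv_const] at hpos
  exact hpos.false

/-- The derivative of `X` enters only through the first derivative of `u`, which vanishes at the
maximum. The Hessian term is a second derivative along the line `p + t • X p`. -/
theorem IsLocalMax.fderiv_fderiv_nonpos {u : E → ℝ} {X : E → E} {p : E} (h : IsLocalMax u p)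
    (hu : ContDiffAt ℝ 2 u p) (hX : DifferentiableAt ℝ X p) :
    fderiv ℝ (fun y ↦ fderiv ℝ u y (X y)) p (X p) ≤ 0 := by
  have h2 : DifferentiableAt ℝ (fderiv ℝ u) p :=
    (hu.fderiv_right (m := 1) (by norm_num)).differentiableAt (by norm_num)
  rw [(h2.hasFDerivAt.clm_apply hX.hasFDerivAt).fderiv]
  simp only [add_apply, ContinuousLinearMap.comp_apply, ContinuousLinearMap.flip_apply,
    h.fderiv_eq_zero, zero_apply, zero_add]
  set v := X p
  let c : ℝ → E := fun t ↦ p + t • v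
  have hc (t : ℝ) : HasDerivAt c v t := by
    simpa [c] using ((hasDerivAt_id t).smul_const v).const_add p
  have hc0 : c 0 = p := by simp [c]
  have hcc : ContinuousAt c 0 := (hc 0).continuousAt
  have hcc' : Filter.Tendsto c (nhds 0) (nhds p) := by simpa [ContinuousAt, hc0] using hcc
  have hmax : IsLocalMax (u ∘ c) 0 := by
    have : IsLocalMax u (c 0) := by rwa [hc0]
    exact this.comp_continuous hcc
  have hcont : ContinuousAt (u ∘ c) 0 :=
    ContinuousAt.comp (by rw [hc0]; exact hu.continuousAt) hcc
  have hd : deriv (u ∘ c) =ᶠ[nhds 0] fun t ↦ fderiv ℝ u (c t) v := by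
    have hev : ∀ᶠ y in nhds p, ContDiffAt ℝ 2 u y := hu.eventually (by simp)
    filter_upwards [hcc'.eventually hev] with t ht
    exact ((ht.differentiableAt (by norm_num)).hasFDerivAt.comp_hasDerivAt t (hc t)).deriv
  have hdd : HasDerivAt (fun t ↦ fderiv ℝ u (c t) v) (fderiv ℝ (fderiv ℝ u) p v v) 0 := by
    have h2' : HasFDerivAt (fderiv ℝ u) (fderiv ℝ (fderiv ℝ u) p) (c 0) := by
      rw [hc0]; exact h2.hasFDerivAt
    have := (h2'.comp_hasDerivAt 0 (hc 0)).clm_apply (hasDerivAt_const (0 : ℝ) v)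
    simpa using this
  have := hmax.deriv_deriv_nonpos hcont
  rwa [hd.deriv_eq, hdd.deriv] at this

end secondDerivativeTest

open TrivialBundle

/-! ### Almost Hermitian structures on open subsets of a vector space -/


/-- A metric `G`, an almost complex structure `J` and Christoffel symbols `Γ` on an open subset `U`
of a vector space, such that `Γ` is the canonical connection of `(G, J)`. -/
structure IsLocalAlmostHermitian {E : Type*} [NormedAddCommGroup E] [NormedSpace ℝ E] (U : Set E)
    (G : E → E →L[ℝ] E →L[ℝ] ℝ) (J : E → E →L[ℝ] E) (Γ : E → E →L[ℝ] E →L[ℝ] E) : Prop where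
  isOpen : IsOpen U
  contDiffOn_G : ContDiffOn ℝ ∞ G U
  contDiffOn_J : ContDiffOn ℝ ∞ J U
  symm : ∀ y ∈ U, ∀ a b, G y a b = G y b a
  pos : ∀ y ∈ U, ∀ a, a ≠ 0 → 0 < G y a a
  J_J : ∀ y ∈ U, ∀ a, J y (J y a) = -a
  G_J_J : ∀ y ∈ U, ∀ a b, G y (J y a) (J y b) = G y a b
  metric : ∀ y ∈ U, ∀ a b c, fderiv ℝ G y a b c = G y (Γ y a b) c + G y b (Γ y a c)
  complex : ∀ y ∈ U, ∀ a b, fderiv ℝ J y a b = J y (Γ y a b) - Γ y a (J y b)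
  torsion : ∀ y ∈ U, ∀ a b,
    Γ y a b - Γ y b a + (Γ y (J y a) (J y b) - Γ y (J y b) (J y a)) = 0

/-! ### Torsion identities and regularity of the canonical connection -/

namespace IsLocalAlmostHermitian

variable {E : Type*} [NormedAddCommGroup E] [NormedSpace ℝ E] {U : Set E}
  {G : E → E →L[ℝ] E →L[ℝ] ℝ} {J : E → E →L[ℝ] E} {Γ : E → E →L[ℝ] E →L[ℝ] E}
  (h : IsLocalAlmostHermitian U G J Γ) {y : E}

include h

theorem nonneg (hy : y ∈ U) (a : E) : 0 ≤ G y a a := by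
  rcases eq_or_ne a 0 with rfl | ha
  · simp
  · exact (h.pos y hy a ha).le

theorem G_J_left (hy : y ∈ U) (a b : E) : G y (J y a) b = -G y a (J y b) := by
  rw [← h.G_J_J y hy a (J y b), h.J_J y hy]; simp

/-- For the pair `a`, `J a` the two summands of the torsion condition coincide, so the torsion
itself vanishes on this pair. -/
theorem torsion_J (hy : y ∈ U) (a : E) : Γ y a (J y a) = Γ y (J y a) a := by
  have := h.torsion y hy a (J y a)
  simp only [h.J_J y hy, map_neg, neg_apply] at this
  have h2 : (2 : ℝ) • (Γ y a (J y a) - Γ y (J y a) a) = 0 := by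
    rw [← this]; module
  exact sub_eq_zero.1 ((smul_eq_zero_iff_right two_ne_zero).1 h2)

theorem contDiffAt_G (hy : y ∈ U) : ContDiffAt ℝ ∞ G y :=
  (h.contDiffOn_G y hy).contDiffAt (h.isOpen.mem_nhds hy)

theorem contDiffAt_J (hy : y ∈ U) : ContDiffAt ℝ ∞ J y :=
  (h.contDiffOn_J y hy).contDiffAt (h.isOpen.mem_nhds hy)

theorem differentiableAt_G (hy : y ∈ U) : DifferentiableAt ℝ G y :=
  (h.contDiffAt_G hy).differentiableAt (by simp)

theorem differentiableAt_J (hy : y ∈ U) : DifferentiableAt ℝ J y :=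
  (h.contDiffAt_J hy).differentiableAt (by simp)

/-- The `(0,1)`-part of the connection depends on `J` alone: combine the torsion condition for `(u,
w)` with `J` applied to the one for `(u, J w)`, and use `∇J = 0`. -/
theorem dbar_eq (hy : y ∈ U) (u w : E) : Γ y u w + J y (Γ y (J y u) w) =
    (2⁻¹ : ℝ) • (fderiv ℝ J y (J y u) w - fderiv ℝ J y (J y w) u - J y (fderiv ℝ J y w u)
      - J y (fderiv ℝ J y u w)) := by
  have t1 := h.torsion y hy u w
  have t2 := congrArg (J y) (h.torsion y hy u (J y w))
  simp only [h.complex y hy, map_sub, map_add, h.J_J y hy, map_neg, neg_apply, map_zero] at t1 t2 ⊢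
  linear_combination (norm := module) (2⁻¹ : ℝ) • t1 - (2⁻¹ : ℝ) • t2

/-- An explicit formula for the canonical connection in terms of `G` and `J`. -/
theorem G_Γ_eq (hy : y ∈ U) (u w z : E) : G y (Γ y u w) z = 2⁻¹ * (
    2⁻¹ * G y (fderiv ℝ J y (J y u) w - fderiv ℝ J y (J y w) u - J y (fderiv ℝ J y w u)
      - J y (fderiv ℝ J y u w)) z
    - 2⁻¹ * G y w (fderiv ℝ J y (J y u) z - fderiv ℝ J y (J y z) u - J y (fderiv ℝ J y z u)
      - J y (fderiv ℝ J y u z))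
    + fderiv ℝ G y u w z - fderiv ℝ G y (J y u) (J y w) z - G y (fderiv ℝ J y (J y u) w) z) := by
  -- `e1` and `e2` give the `(0,1)`-parts. The `(1,0)`-part, paired with `z`, is obtained from `∇G =
  -- 0` in the directions `u` and `J u`, which transfers it to the `(0,1)`-part acting on `z`; the
  -- two parts add up to `2 Γ`.
  have e1 := congrArg (fun v ↦ G y v z) (h.dbar_eq hy u w)
  have e2 := congrArg (fun v ↦ G y w v) (h.dbar_eq hy u z)
  simp only [map_smul, smul_apply, smul_eq_mul] at e1 e2
  rw [← e1, ← e2, h.metric y hy, h.metric y hy, h.complex y hy (J y u) w]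
  simp only [map_add, map_sub, add_apply, sub_apply, h.G_J_left hy]
  ring

-- Regularity of `Γ` is not part of the definition. It follows from `G_Γ_eq`, which expresses `G ∘
-- Γ` by `G`, `J` and their first derivatives, after inverting the nondegenerate form `G`. The
-- curvature needs only one derivative of `Γ`.
set_option maxSynthPendingDepth 3 in
theorem contDiffOn_Γ [FiniteDimensional ℝ E] : ContDiffOn ℝ 1 Γ U := by
  have : CompleteSpace E := FiniteDimensional.complete ℝ E
  refine contDiffOn_clm_apply.2 fun u ↦ contDiffOn_clm_apply.2 fun w ↦ ?_
  have hG : ContDiffOn ℝ 1 G U := h.contDiffOn_G.of_le ENat.LEInfty.out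
  have hJ : ContDiffOn ℝ 1 J U := h.contDiffOn_J.of_le ENat.LEInfty.out
  have hdG : ContDiffOn ℝ 1 (fderiv ℝ G) U :=
    (h.contDiffOn_G.fderiv_of_isOpen h.isOpen (m := ∞) (by simp)).of_le ENat.LEInfty.out
  have hdJ : ContDiffOn ℝ 1 (fderiv ℝ J) U :=
    (h.contDiffOn_J.fderiv_of_isOpen h.isOpen (m := ∞) (by simp)).of_le ENat.LEInfty.out
  have hK : ContDiffOn ℝ 1 (fun y ↦ G y (Γ y u w)) U := by
    refine contDiffOn_clm_apply.2 fun z ↦ ContDiffOn.congr ?_ fun y hy ↦ h.G_Γ_eq hy u w z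
    have c {v : E} : ContDiffOn ℝ 1 (fun _ : E ↦ v) U := contDiffOn_const
    have Jc {a : E → E} (ha : ContDiffOn ℝ 1 a U) : ContDiffOn ℝ 1 (fun y ↦ J y (a y)) U :=
      hJ.clm_apply ha
    have dJc {a b : E → E} (ha : ContDiffOn ℝ 1 a U) (hb : ContDiffOn ℝ 1 b U) :
        ContDiffOn ℝ 1 (fun y ↦ fderiv ℝ J y (a y) (b y)) U := (hdJ.clm_apply ha).clm_apply hb
    have Gc {a b : E → E} (ha : ContDiffOn ℝ 1 a U) (hb : ContDiffOn ℝ 1 b U) :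
        ContDiffOn ℝ 1 (fun y ↦ G y (a y) (b y)) U := (hG.clm_apply ha).clm_apply hb
    have dGc {a b : E → E} (ha : ContDiffOn ℝ 1 a U) (hb : ContDiffOn ℝ 1 b U) :
        ContDiffOn ℝ 1 (fun y ↦ fderiv ℝ G y (a y) (b y) z) U :=
      ((hdG.clm_apply ha).clm_apply hb).clm_apply c
    have N (v : E) := (((dJc (Jc (c (v := u))) (c (v := v))).sub (dJc (Jc (c (v := v))) (c (v := u)))).sub
      (Jc (dJc (c (v := v)) (c (v := u))))).sub (Jc (dJc (c (v := u)) (c (v := v))))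
    exact contDiffOn_const.mul (((((contDiffOn_const.mul (Gc (N w) c)).sub
      (contDiffOn_const.mul (Gc c (N z)))).add (dGc c c)).sub (dGc (Jc c) (Jc c))).sub
        (Gc (dJc (Jc c) c) c))
  intro y hy
  have hinv : ∀ y ∈ U, (G y).IsInvertible := by
    intro y hy
    have hinj : Function.Injective (G y).toLinearMap := by
      refine (injective_iff_map_eq_zero (G y)).2 fun a ha ↦ ?_
      by_contra hne
      have := h.pos y hy a hne
      simp [ha] at this
    let D : (E →ₗ[ℝ] ℝ) ≃ₗ[ℝ] (E →L[ℝ] ℝ) := LinearMap.toContinuousLinearMap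
    have hr : Module.finrank ℝ E = Module.finrank ℝ (E →L[ℝ] ℝ) := by
      rw [← D.finrank_eq]; exact (Subspace.dual_finrank_eq).symm
    exact ⟨(LinearMap.linearEquivOfInjective _ hinj hr).toContinuousLinearEquiv, by ext; rfl⟩
  have hinvd : ContDiffAt ℝ 1 (fun y ↦ (G y).inverse) y :=
    (hinv y hy).contDiffAt_map_inverse.comp y ((h.contDiffAt_G hy).of_le ENat.LEInfty.out)
  refine (hinvd.contDiffWithinAt.clm_apply (hK y hy)).congr (fun z hz ↦ ?_) ?_
  · exact ((hinv z hz).inverse_apply_self _).symm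
  · exact ((hinv y hy).inverse_apply_self _).symm

theorem differentiableAt_Γ [FiniteDimensional ℝ E] (hy : y ∈ U) : DifferentiableAt ℝ Γ y :=
  ((h.contDiffOn_Γ y hy).contDiffAt (h.isOpen.mem_nhds hy)).differentiableAt (by norm_num)

end IsLocalAlmostHermitian

/-! ### Almost holomorphic maps in coordinates and the curvature comparison -/

namespace IsLocalAlmostHermitian

variable {E : Type*} [NormedAddCommGroup E] [NormedSpace ℝ E] {U : Set E}
  {G : E → E →L[ℝ] E →L[ℝ] ℝ} {J : E → E →L[ℝ] E} {Γ : E → E →L[ℝ] E →L[ℝ] E}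
  {E' : Type*} [NormedAddCommGroup E'] [NormedSpace ℝ E'] {U' : Set E'}
  {G' : E' → E' →L[ℝ] E' →L[ℝ] ℝ} {J' : E' → E' →L[ℝ] E'} {Γ' : E' → E' →L[ℝ] E' →L[ℝ] E'}

theorem fderiv_comp_apply {W : Type*} [NormedAddCommGroup W] [NormedSpace ℝ W] {T : E' → W}
    {F : E → E'} {y : E} (hT : DifferentiableAt ℝ T (F y)) (hF : DifferentiableAt ℝ F y) (a : E) :
    fderiv ℝ (fun y ↦ T (F y)) y a = fderiv ℝ T (F y) (fderiv ℝ F y a) := by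
  rw [fderiv_fun_comp y hT hF]; rfl

/-- The pullback of a connection form along `F`. -/
noncomputable def pullback (Γ' : E' → E' →L[ℝ] E' →L[ℝ] E') (F : E → E') (y : E) :
    E →L[ℝ] E' →L[ℝ] E' := (Γ' (F y)).comp (fderiv ℝ F y)

theorem differentiableAt_pullback {F : E → E'} {p : E} (hF : ContDiffAt ℝ 2 F p)
    (hΓ : DifferentiableAt ℝ Γ' (F p)) : DifferentiableAt ℝ (pullback Γ' F) p := by
  have h2 : DifferentiableAt ℝ (fderiv ℝ F) p :=
    (hF.fderiv_right (m := 1) (by norm_num)).differentiableAt (by norm_num)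
  exact (hΓ.comp p (hF.differentiableAt (by norm_num))).clm_comp h2

-- The derivative of the pulled back form also contains the Hessian of `F`; it is symmetric and
-- drops out of the antisymmetrization.
set_option maxSynthPendingDepth 3 in
theorem curv_pullback {F : E → E'} {p : E} (hF : ContDiffAt ℝ 2 F p)
    (hΓ : DifferentiableAt ℝ Γ' (F p)) (a b : E) (σ : E') :
    curv (pullback Γ' F) p a b σ = curv Γ' (F p) (fderiv ℝ F p a) (fderiv ℝ F p b) σ := by
  have h2 : DifferentiableAt ℝ (fderiv ℝ F) p :=
    (hF.fderiv_right (m := 1) (by norm_num)).differentiableAt (by norm_num)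
  have hsym : fderiv ℝ (fderiv ℝ F) p a b = fderiv ℝ (fderiv ℝ F) p b a :=
    (hF.isSymmSndFDerivAt (by simp)).eq _ _
  have hc : HasFDerivAt (fun y ↦ Γ' (F y)) ((fderiv ℝ Γ' (F p)).comp (fderiv ℝ F p)) p :=
    hΓ.hasFDerivAt.comp p (hF.differentiableAt (by norm_num)).hasFDerivAt
  have hd := hc.clm_comp h2.hasFDerivAt
  have hd' : fderiv ℝ (pullback Γ' F) p = _ := hd.fderiv
  simp only [curv, hd']
  simp [pullback, hsym]

/-- The differential of an almost holomorphic map commutes with the `(0,1)`-part of the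
covariant derivative, by the vanishing of the `(1,1)`-part of the torsion. -/
theorem covD_pullback (h : IsLocalAlmostHermitian U G J Γ)
    (h' : IsLocalAlmostHermitian U' G' J' Γ') {F : E → E'} (hF : ContDiffOn ℝ ∞ F U)
    (hUU' : Set.MapsTo F U U')
    (hol : ∀ y ∈ U, ∀ v, fderiv ℝ F y (J y v) = J' (F y) (fderiv ℝ F y v))
    {X : E → E} {y : E} (hy : y ∈ U) (hX : DifferentiableAt ℝ X y) :
    covD (pullback Γ' F) (fun z ↦ fderiv ℝ F z (X z)) y (X y)
      + J' (F y) (covD (pullback Γ' F) (fun z ↦ fderiv ℝ F z (X z)) y (J y (X y)))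
      = fderiv ℝ F y (covD Γ X y (X y) + J y (covD Γ X y (J y (X y)))) := by
  have hF2 : ContDiffAt ℝ 2 F y :=
    ((hF y hy).contDiffAt (h.isOpen.mem_nhds hy)).of_le ENat.LEInfty.out
  have h2 : DifferentiableAt ℝ (fderiv ℝ F) y :=
    (hF2.fderiv_right (m := 1) (by norm_num)).differentiableAt (by norm_num)
  have h1 : DifferentiableAt ℝ F y := hF2.differentiableAt (by norm_num)
  have hsym : fderiv ℝ (fderiv ℝ F) y (J y (X y)) (X y)
      = fderiv ℝ (fderiv ℝ F) y (X y) (J y (X y)) :=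
    (hF2.isSymmSndFDerivAt (by simp)).eq _ _
  have hy' := hUU' hy
  have hJ := h.differentiableAt_J hy
  have hJ' := h'.differentiableAt_J hy'
  have e1 := h2.hasFDerivAt.clm_apply
    (hJ.hasFDerivAt.clm_apply (hasFDerivAt_const (X y) y))
  have e2 := (hJ'.hasFDerivAt.comp y h1.hasFDerivAt).clm_apply
    (h2.hasFDerivAt.clm_apply (hasFDerivAt_const (X y) y))
  have heq : (fun z ↦ fderiv ℝ F z (J z (X y))) =ᶠ[nhds y] fun z ↦ J' (F z) (fderiv ℝ F z (X y)) := by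
    filter_upwards [h.isOpen.mem_nhds hy] with z hz using hol z hz _
  -- The equation `dF ∘ J = J' ∘ dF` is differentiated in the direction `X y`, with the vector `X y`
  -- held fixed, and `J'` is applied. The derivatives of `J` and `J'` become Christoffel terms, and
  -- `torsion_J` exchanges the two slots of `Γ (X, JX)` in both manifolds.
  have e3 := congrArg (J' (F y)) (congrArg (fun L : E →L[ℝ] E' ↦ L (X y))
    (e1.fderiv.symm.trans (heq.fderiv_eq.trans e2.fderiv)))
  simp only [add_apply, ContinuousLinearMap.comp_apply, ContinuousLinearMap.flip_apply, map_add,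
    Function.comp_apply, zero_apply, map_zero, zero_add, h'.J_J _ hy', h'.complex _ hy', map_sub,
    h.complex _ hy, hol _ hy, h'.torsion_J hy', h.torsion_J hy] at e3
  have es := (h2.hasFDerivAt.clm_apply hX.hasFDerivAt).fderiv
  simp only [covD, es]
  simp only [pullback, add_apply, ContinuousLinearMap.comp_apply, ContinuousLinearMap.flip_apply,
    map_add, hol _ hy, hsym]
  linear_combination (norm := module) e3

set_option maxSynthPendingDepth 3 in
/-- The comparison of holomorphic curvatures at a maximum of `|dF v|² / |v|²`. -/
theorem curv_le_of_isMax [FiniteDimensional ℝ E] [FiniteDimensional ℝ E']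
    (h : IsLocalAlmostHermitian U G J Γ)
    (h' : IsLocalAlmostHermitian U' G' J' Γ') {F : E → E'} (hF : ContDiffOn ℝ ∞ F U)
    (hUU' : Set.MapsTo F U U')
    (hol : ∀ y ∈ U, ∀ v, fderiv ℝ F y (J y v) = J' (F y) (fderiv ℝ F y v))
    {l : ℝ} {p v : E} (hp : p ∈ U)
    (hmax : ∀ y ∈ U, ∀ v, G' (F y) (fderiv ℝ F y v) (fderiv ℝ F y v) ≤ l * G y v v)
    (heq : G' (F p) (fderiv ℝ F p v) (fderiv ℝ F p v) = l * G p v v) :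
    l * G p (curv Γ p v (J p v) (J p v)) v ≤
      G' (F p) (curv Γ' (F p) (fderiv ℝ F p v) (J' (F p) (fderiv ℝ F p v))
        (J' (F p) (fderiv ℝ F p v))) (fderiv ℝ F p v) := by
  have hp' := hUU' hp
  have hFp : ContDiffAt ℝ ∞ F p := (hF p hp).contDiffAt (h.isOpen.mem_nhds hp)
  have hF2 : ContDiffAt ℝ 2 F p := hFp.of_le ENat.LEInfty.out
  have hdF : ContDiffOn ℝ ∞ (fderiv ℝ F) U := hF.fderiv_of_isOpen h.isOpen (by simp)
  have h2 : DifferentiableAt ℝ (fderiv ℝ F) p :=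
    (hF2.fderiv_right (m := 1) (by norm_num)).differentiableAt (by norm_num)
  have hΓ := h.differentiableAt_Γ hp
  have hΓ' := h'.differentiableAt_Γ hp'
  -- `v` lies in the kernel of the form `G'(dF, dF) - l G`
  have hker (a : E) : G' (F p) (fderiv ℝ F p a) (fderiv ℝ F p v) - l * G p a v = 0 := by
    set b := G' (F p) (fderiv ℝ F p a) (fderiv ℝ F p v) - l * G p a v
    -- The form `l G - G'(dF, dF)` at `v + t • a` is a nonnegative quadratic in `t` whose constant
    -- term is zero by `heq`. Its discriminant is `4 b²`.
    have hd : discrim (-(G' (F p) (fderiv ℝ F p a) (fderiv ℝ F p a) - l * G p a a)) (-2 * b) 0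
        ≤ 0 := by
      refine discrim_le_zero fun t ↦ ?_
      have := hmax p hp (v + t • a)
      simp only [map_add, map_smul, add_apply, smul_apply, smul_eq_mul,
        h.symm p hp v a, h'.symm _ hp' (fderiv ℝ F p v) (fderiv ℝ F p a), heq] at this
      simp only [b]
      linarith
    simp only [discrim] at hd
    nlinarith [sq_nonneg b]
  -- a vector field extending `v` that is parallel at `p`
  let X : E → E := fun y ↦ v - Γ p (y - p) v
  have hXp : X p = v := by simp [X]
  have hXs : ContDiff ℝ ∞ X := by
    have : ContDiff ℝ ∞ (fun y ↦ Γ p (y - p)) := (Γ p).contDiff.comp (contDiff_id.sub contDiff_const)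
    exact contDiff_const.sub (this.clm_apply contDiff_const)
  have hXd (y : E) : DifferentiableAt ℝ X y := hXs.differentiable (by simp) y
  have hcX (a : E) : covD Γ X p a = 0 := by
    have : HasFDerivAt X (0 - ((Γ p).flip v).comp (ContinuousLinearMap.id ℝ E - 0)) p :=
      (hasFDerivAt_const v p).sub (((Γ p).flip v).hasFDerivAt.comp p
        ((hasFDerivAt_id p).sub (hasFDerivAt_const p p)))
    simp [covD, this.fderiv, hXp]
  let Y : E → E := fun y ↦ J y (X y)
  have hYd : DifferentiableAt ℝ Y p := (h.differentiableAt_J hp).clm_apply (hXd p)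
  -- At `p` both `∇_X (JX) = J ∇_X X` and `∇_{JX} X` vanish, and the torsion vanishes on `X`, `JX`;
  -- hence so does the bracket.
  have hXY : fderiv ℝ Y p (X p) = fderiv ℝ X p (Y p) := by
    have e1 := covD_complex (A := Γ) (h.differentiableAt_J hp) (hXd p) (h.complex p hp (X p))
    have e2 := hcX (Y p)
    rw [hcX, map_zero] at e1
    rw [covD] at e1 e2
    have e3 := h.torsion_J hp (X p)
    exact (eq_neg_of_add_eq_zero_left e1).trans
      ((congrArg Neg.neg e3).trans (eq_neg_of_add_eq_zero_left e2).symm)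
  -- Since `Z` vanishes at `p`, its covariant derivative there is the plain derivative, and applying
  -- `dF` produces no Hessian term in `hcZ'`.
  let Z : E → E := fun y ↦ covD Γ X y (X y) + J y (covD Γ X y (Y y))
  have hZp : Z p = 0 := by simp [Z, hcX]
  have hX2 : ContDiffAt ℝ 2 X p := hXs.contDiffAt.of_le ENat.LEInfty.out
  have hZd : DifferentiableAt ℝ Z p := (differentiableAt_covD hX2 hΓ (hXd p)).add
    ((h.differentiableAt_J hp).clm_apply (differentiableAt_covD hX2 hΓ hYd))
  have hcZ (a : E) : covD Γ Z p a = fderiv ℝ Z p a := by simp [covD, hZp]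
  have B1 := fderiv_fderiv_metric h.isOpen hp hΓ hXs.contDiffOn (hXd p) hYd hXY h.contDiffOn_J
    h.complex h.contDiffOn_G (h.symm p hp) h.metric (Z := Z) (fun _ _ ↦ rfl) (h.J_J p hp)
  let s : E → E' := fun y ↦ fderiv ℝ F y (X y)
  have hs : ContDiffOn ℝ ∞ s U := hdF.clm_apply hXs.contDiffOn
  let Z' : E → E' := fun y ↦ fderiv ℝ F y (Z y)
  have hcZ' (a : E) : covD (pullback Γ' F) Z' p a = fderiv ℝ F p (fderiv ℝ Z p a) := by
    have := (h2.hasFDerivAt.clm_apply hZd.hasFDerivAt).fderiv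
    have e : fderiv ℝ Z' p = _ := this
    simp [covD, e, hZp, Z']
  have hJ'F : ContDiffOn ℝ ∞ (fun y ↦ J' (F y)) U := h'.contDiffOn_J.comp hF hUU'
  have hG'F : ContDiffOn ℝ ∞ (fun y ↦ G' (F y)) U := h'.contDiffOn_G.comp hF hUU'
  have hdF1 : ∀ y ∈ U, DifferentiableAt ℝ F y := fun y hy ↦
    ((hF y hy).contDiffAt (h.isOpen.mem_nhds hy)).differentiableAt (by simp)
  -- The same Bochner formula for `dF X` in the pulled back bundle: the chain rule makes the pulled
  -- back metric and complex structure parallel, and `covD_pullback` identifies the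
  -- `(0,1)`-derivative with `Z' = dF Z`.
  have B2 := fderiv_fderiv_metric (A := pullback Γ' F) (s := s) (k := fun y ↦ G' (F y))
    (I := fun y ↦ J' (F y)) (Z := Z') h.isOpen hp
    (differentiableAt_pullback hF2 hΓ') hs (hXd p) hYd hXY hJ'F
    (fun y hy a σ ↦ by
      rw [fderiv_comp_apply (h'.differentiableAt_J (hUU' hy)) (hdF1 y hy)]
      simp [h'.complex _ (hUU' hy), pullback]) hG'F (h'.symm _ hp')
    (fun y hy a σ τ ↦ by
      rw [fderiv_comp_apply (h'.differentiableAt_G (hUU' hy)) (hdF1 y hy)]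
      simp [h'.metric _ (hUU' hy), pullback])
    (fun y hy ↦ (covD_pullback h h' hF hUU' hol hy (hXd y)).symm) (h'.J_J _ hp')
  have hsp : s p = fderiv ℝ F p v := by simp [s, hXp]
  have hYp : Y p = J p v := by simp [Y, hXp]
  -- the function `G'(s, s) - l G(X, X)` has a maximum at `p`
  let u₁ : E → ℝ := fun y ↦ G' (F y) (s y) (s y)
  let u₂ : E → ℝ := fun y ↦ G y (X y) (X y)
  have hu₁ : ContDiffOn ℝ ∞ u₁ U := (hG'F.clm_apply hs).clm_apply hs
  have hu₂ : ContDiffOn ℝ ∞ u₂ U :=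
    (h.contDiffOn_G.clm_apply hXs.contDiffOn).clm_apply hXs.contDiffOn
  have hlm : IsLocalMax (fun y ↦ u₁ y - l * u₂ y) p := by
    filter_upwards [h.isOpen.mem_nhds hp] with y hy
    have e1 := hmax y hy (X y)
    simp only [u₁, u₂, s, hXp, heq] at e1 ⊢
    linarith
  have hu : ContDiffAt ℝ 2 (fun y ↦ u₁ y - l * u₂ y) p :=
    (((hu₁.sub (contDiffOn_const.mul hu₂)) p hp).contDiffAt (h.isOpen.mem_nhds hp)).of_le
      ENat.LEInfty.out
  have hdd {w : E → ℝ} (hw : ContDiffOn ℝ ∞ w U) {T : E → E} (hT : DifferentiableAt ℝ T p) :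
      DifferentiableAt ℝ (fun y ↦ fderiv ℝ w y (T y)) p :=
    ((((hw.fderiv_of_isOpen h.isOpen (m := ∞) (by simp)) p hp).contDiffAt
      (h.isOpen.mem_nhds hp)).differentiableAt (by simp)).clm_apply hT
  have split (T : E → E) (hT : DifferentiableAt ℝ T p) :
      fderiv ℝ (fun y ↦ fderiv ℝ u₁ y (T y)) p (T p)
        - l * fderiv ℝ (fun y ↦ fderiv ℝ u₂ y (T y)) p (T p) ≤ 0 := by
    have hle := hlm.fderiv_fderiv_nonpos hu hT
    have e : (fun y ↦ fderiv ℝ (fun y ↦ u₁ y - l * u₂ y) y (T y)) =ᶠ[nhds p]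
        fun y ↦ fderiv ℝ u₁ y (T y) - l * fderiv ℝ u₂ y (T y) := by
      filter_upwards [h.isOpen.mem_nhds hp] with y hy
      have d1 := ((hu₁ y hy).contDiffAt (h.isOpen.mem_nhds hy)).differentiableAt (by simp)
      have d2 := ((hu₂ y hy).contDiffAt (h.isOpen.mem_nhds hy)).differentiableAt (by simp)
      rw [fderiv_fun_sub d1 (d2.const_mul l), fderiv_const_mul d2]
      simp
    rw [e.fderiv_eq, fderiv_fun_sub (hdd hu₁ hT) ((hdd hu₂ hT).const_mul l),
      fderiv_const_mul (hdd hu₂ hT)] at hle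
    simpa using hle
  have s1 := split X (hXd p)
  have s2 := split Y hYd
  have B1' : fderiv ℝ (fun y ↦ fderiv ℝ u₂ y (X y)) p (X p)
    + fderiv ℝ (fun y ↦ fderiv ℝ u₂ y (Y y)) p (Y p) = _ := B1
  have B2' : fderiv ℝ (fun y ↦ fderiv ℝ u₁ y (X y)) p (X p)
    + fderiv ℝ (fun y ↦ fderiv ℝ u₁ y (Y y)) p (Y p) = _ := B2
  rw [hcZ, hcZ, hcX, hcX, hXp, hYp] at B1'
  rw [hcZ', hcZ', curv_pullback hF2 hΓ', hXp, hYp, hsp, hol p hp, ← hol p hp (fderiv ℝ Z p _),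
    ← map_sub] at B2'
  -- The `Z`-terms of the two Bochner formulas differ by the form `G'(dF, dF) - l G` evaluated on
  -- this vector and `v`, which is zero.
  have hk := hker (fderiv ℝ Z p v - J p (fderiv ℝ Z p (J p v)))
  have n1 := h'.nonneg hp' (covD (pullback Γ' F) s p v)
  have n2 := h'.nonneg hp' (covD (pullback Γ' F) s p (J p v))
  simp only [map_zero, add_zero] at B1'
  rw [hXp] at s1
  rw [hYp] at s2
  linear_combination (1 / 2) * s1 + (1 / 2) * s2 - (1 / 2) * B2' + (l / 2) * B1' + n1 + n2 - hk

end IsLocalAlmostHermitian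

/-! ### Vector fields in a chart -/

namespace TangentChart

open Bundle VectorField

variable {E : Type*} [NormedAddCommGroup E] [NormedSpace ℝ E]
  {M : Type*} [TopologicalSpace M] [ChartedSpace E M] [IsManifold 𝓘(ℝ, E) ∞ M]

/-- The isomorphism from the model space to the tangent space at `x` given by the chart at `p`. -/
noncomputable def frame (p x : M) : E →L[ℝ] TangentSpace 𝓘(ℝ, E) x :=
  (trivializationAt E (TangentSpace 𝓘(ℝ, E)) p).symmL ℝ x

/-- The coordinates of a tangent vector at `x` in the chart at `p`. -/
noncomputable def coframe (p x : M) : TangentSpace 𝓘(ℝ, E) x →L[ℝ] E :=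
  (trivializationAt E (TangentSpace 𝓘(ℝ, E)) p).continuousLinearMapAt ℝ x

/-- The vector field on `M` with the coordinate expression `s` in the chart at `p`. -/
noncomputable def lift (p : M) (s : E → E) : Π x : M, TangentSpace 𝓘(ℝ, E) x :=
  fun x ↦ frame p x (s (extChartAt 𝓘(ℝ, E) p x))

variable {p x : M} {s t : E → E}

theorem coframe_frame (hx : x ∈ (chartAt E p).source) (w : E) : coframe p x (frame p x w) = w :=
  (trivializationAt E (TangentSpace 𝓘(ℝ, E)) p).continuousLinearMapAt_symmL hx w

theorem frame_coframe (hx : x ∈ (chartAt E p).source) (v : TangentSpace 𝓘(ℝ, E) x) :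
    frame p x (coframe p x v) = v :=
  (trivializationAt E (TangentSpace 𝓘(ℝ, E)) p).symmL_continuousLinearMapAt hx v

theorem snd_trivializationAt (hx : x ∈ (chartAt E p).source) (v : TangentSpace 𝓘(ℝ, E) x) :
    (trivializationAt E (TangentSpace 𝓘(ℝ, E)) p ⟨x, v⟩).2 = coframe p x v := by
  have hx' : x ∈ (trivializationAt E (TangentSpace 𝓘(ℝ, E)) p).baseSet := hx
  rw [coframe, Trivialization.continuousLinearMapAt_apply, Trivialization.coe_linearMapAt_of_mem _ hx']

theorem coframe_eq (hx : x ∈ (chartAt E p).source) :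
    coframe p x = mfderiv 𝓘(ℝ, E) 𝓘(ℝ, E) (extChartAt 𝓘(ℝ, E) p) x :=
  TangentBundle.continuousLinearMapAt_trivializationAt hx

theorem contMDiffAt_section_iff {σ : Π x : M, TangentSpace 𝓘(ℝ, E) x} {n : ℕ∞}
    (hx : x ∈ (chartAt E p).source) :
    CMDiffAt n (T% σ) x ↔ CMDiffAt n (fun y ↦ coframe p y (σ y)) x := by
  have hx' : x ∈ (trivializationAt E (TangentSpace 𝓘(ℝ, E)) p).baseSet := hx
  have : IsManifold 𝓘(ℝ, E) (n + 1) M := IsManifold.of_le (n := ∞) (by exact_mod_cast le_top)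
  rw [(trivializationAt E (TangentSpace 𝓘(ℝ, E)) p).contMDiffAt_section_iff hx']
  refine Filter.EventuallyEq.contMDiffAt_iff ?_
  filter_upwards [(chartAt E p).open_source.mem_nhds hx] with y hy using snd_trivializationAt hy _

theorem mdifferentiableAt_section_iff {σ : Π x : M, TangentSpace 𝓘(ℝ, E) x}
    (hx : x ∈ (chartAt E p).source) :
    MDiffAt (T% σ) x ↔ MDiffAt (fun y ↦ coframe p y (σ y)) x := by
  have hx' : x ∈ (trivializationAt E (TangentSpace 𝓘(ℝ, E)) p).baseSet := hx
  rw [(trivializationAt E (TangentSpace 𝓘(ℝ, E)) p).mdifferentiableAt_section_iff _ _ hx']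
  refine Filter.EventuallyEq.mdifferentiableAt_iff ?_
  filter_upwards [(chartAt E p).open_source.mem_nhds hx] with y hy using snd_trivializationAt hy _

theorem coframe_lift (hx : x ∈ (chartAt E p).source) :
    coframe p x (lift p s x) = s (extChartAt 𝓘(ℝ, E) p x) := coframe_frame hx _

theorem mdifferentiableAt_lift (hx : x ∈ (chartAt E p).source)
    (hs : DifferentiableAt ℝ s (extChartAt 𝓘(ℝ, E) p x)) : MDiffAt (T% (lift p s)) x := by
  rw [mdifferentiableAt_section_iff hx]
  have h1 : MDiffAt (s ∘ extChartAt 𝓘(ℝ, E) p) x :=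
    hs.mdifferentiableAt.comp x (mdifferentiableAt_extChartAt hx)
  refine h1.congr_of_eventuallyEq ?_
  filter_upwards [(chartAt E p).open_source.mem_nhds hx] with y hy using coframe_lift hy

theorem contMDiffAt_lift_const (hx : x ∈ (chartAt E p).source) (w : E) :
    CMDiffAt ∞ (T% (lift p (fun _ ↦ w))) x := by
  refine (contMDiffAt_section_iff (n := ⊤) hx).2 ?_
  refine (contMDiffAt_const (c := w)).congr_of_eventuallyEq ?_
  filter_upwards [(chartAt E p).open_source.mem_nhds hx] with y hy using coframe_lift hy

theorem mdifferentiableAt_extChartAt_symm (hx : x ∈ (chartAt E p).source) :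
    MDiffAt (extChartAt 𝓘(ℝ, E) p).symm (extChartAt 𝓘(ℝ, E) p x) := by
  have hx' : x ∈ (extChartAt 𝓘(ℝ, E) p).source := by rwa [extChartAt_source]
  have := mdifferentiableWithinAt_extChartAt_symm (I := 𝓘(ℝ, E))
    ((extChartAt 𝓘(ℝ, E) p).map_source hx')
  rwa [modelWithCornersSelf_coe, Set.range_id, mdifferentiableWithinAt_univ] at this

theorem mvfderiv_eq {W : Type*} [NormedAddCommGroup W] [NormedSpace ℝ W] {f : M → W}
    (hx : x ∈ (chartAt E p).source) (hf : MDiffAt f x) (v : TangentSpace 𝓘(ℝ, E) x) :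
    mvfderiv 𝓘(ℝ, E) f x v
      = fderiv ℝ (f ∘ (extChartAt 𝓘(ℝ, E) p).symm) (extChartAt 𝓘(ℝ, E) p x) (coframe p x v) := by
  have hx' : x ∈ (extChartAt 𝓘(ℝ, E) p).source := by rwa [extChartAt_source]
  have e : f =ᶠ[nhds x] (f ∘ (extChartAt 𝓘(ℝ, E) p).symm) ∘ extChartAt 𝓘(ℝ, E) p := by
    filter_upwards [(chartAt E p).open_source.mem_nhds hx] with y hy
    have hy' : y ∈ (extChartAt 𝓘(ℝ, E) p).source := by rwa [extChartAt_source]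
    simp only [Function.comp_apply, (extChartAt 𝓘(ℝ, E) p).left_inv hy']
  have hf' : MDiffAt f ((extChartAt 𝓘(ℝ, E) p).symm (extChartAt 𝓘(ℝ, E) p x)) := by
    rwa [(extChartAt 𝓘(ℝ, E) p).left_inv hx']
  have h1 : MDiffAt (f ∘ (extChartAt 𝓘(ℝ, E) p).symm) (extChartAt 𝓘(ℝ, E) p x) :=
    hf'.comp _ (mdifferentiableAt_extChartAt_symm hx)
  rw [coframe_eq hx, ← mfderiv_eq_fderiv]
  have h2 := mfderiv_comp_apply x h1 (mdifferentiableAt_extChartAt hx) v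
  rw [← e.mfderiv_eq] at h2
  exact h2

theorem mvfderiv_frame {W : Type*} [NormedAddCommGroup W] [NormedSpace ℝ W] {f : M → W}
    (hx : x ∈ (chartAt E p).source) (hf : MDiffAt f x) (a : E) :
    mvfderiv 𝓘(ℝ, E) f x (frame p x a)
      = fderiv ℝ (f ∘ (extChartAt 𝓘(ℝ, E) p).symm) (extChartAt 𝓘(ℝ, E) p x) a := by
  rw [mvfderiv_eq hx hf, coframe_frame hx]

/-- A constant vector field on a vector space. -/
def constField (w : E) : Π y : E, TangentSpace 𝓘(ℝ, E) y := fun _ ↦ w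

/-- Near `x` these fields are the pullbacks of constant fields under the chart, and the Lie bracket
commutes with pullback. -/
theorem mlieBracket_lift_const [CompleteSpace E] (hx : x ∈ (chartAt E p).source) (a b : E) :
    mlieBracket 𝓘(ℝ, E) (lift p (fun _ ↦ a)) (lift p (fun _ ↦ b)) x = 0 := by
  have key (w : E) : mpullback 𝓘(ℝ, E) 𝓘(ℝ, E) (extChartAt 𝓘(ℝ, E) p)
      (constField w) =ᶠ[nhds x] lift p (fun _ ↦ w) := by
    filter_upwards [(chartAt E p).open_source.mem_nhds hx] with y hy
    have hy' : y ∈ (extChartAt 𝓘(ℝ, E) p).source := by rwa [extChartAt_source]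
    refine ((isInvertible_mfderiv_extChartAt hy').inverse_apply_eq).2 ?_
    rw [← coframe_eq hy]
    exact (coframe_frame hy w).symm
  rw [← (key a).mlieBracket_vectorField_eq (key b)]
  have hc (w : E) : MDiffAt (T% (constField w)) (extChartAt 𝓘(ℝ, E) p x) := by
    have := (contMDiffAt_vectorSpace_iff_contDiffAt (𝕜 := ℝ) (n := 1)
      (V := constField w) (x := extChartAt 𝓘(ℝ, E) p x)).2 contDiffAt_const
    exact this.mdifferentiableAt (by norm_num)
  have h1 : CMDiffAt ∞ (extChartAt 𝓘(ℝ, E) p) x := contMDiffAt_extChartAt' hx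
  have h2le : minSmoothness ℝ 2 ≤ ∞ := by
    rw [minSmoothness_of_isRCLikeNormedField]; exact ENat.LEInfty.out
  have : IsManifold 𝓘(ℝ, E) (minSmoothness ℝ 2) M := IsManifold.of_le h2le
  have h2 := mpullback_mlieBracket (hc a) (hc b) h1 h2le
  rw [← h2, mpullback_apply]
  have h0 : mlieBracket 𝓘(ℝ, E) (constField a) (constField b) (extChartAt 𝓘(ℝ, E) p x) = 0 := by
    have e (z : E) : lieBracketWithin ℝ (fun _ : E ↦ a) (fun _ ↦ b) Set.univ z = 0 := by
      simp [lieBracketWithin]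
    rw [← mlieBracketWithin_univ, mlieBracketWithin_eq_lieBracketWithin]
    exact e _
  rw [h0, map_zero]

end TangentChart

open TangentChart

/-! ### Expression of an almost Hermitian structure in a chart -/

namespace AlmostHermitianStructure

open Bundle VectorField

variable {E : Type*} [NormedAddCommGroup E] [NormedSpace ℝ E]
  {M : Type*} [TopologicalSpace M] [ChartedSpace E M] [IsManifold 𝓘(ℝ, E) ∞ M]
  (h : AlmostHermitianStructure E M) (p : M)

/-- The metric in the chart at `p`. -/
noncomputable def chartMetric (z : E) : E →L[ℝ] E →L[ℝ] ℝ :=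
  (ContinuousLinearMap.precomp ℝ (frame p ((extChartAt 𝓘(ℝ, E) p).symm z))).comp
    ((h.g.inner ((extChartAt 𝓘(ℝ, E) p).symm z)).comp (frame p ((extChartAt 𝓘(ℝ, E) p).symm z)))

/-- The almost complex structure in the chart at `p`. -/
noncomputable def chartJ (z : E) : E →L[ℝ] E :=
  (coframe p ((extChartAt 𝓘(ℝ, E) p).symm z)).comp ((h.J ((extChartAt 𝓘(ℝ, E) p).symm z)).comp
    (frame p ((extChartAt 𝓘(ℝ, E) p).symm z)))

variable {h p} {x : M} {z : E}

theorem chartMetric_symm_apply (a b : E) : h.chartMetric p z a b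
    = h.g.inner ((extChartAt 𝓘(ℝ, E) p).symm z) (frame p ((extChartAt 𝓘(ℝ, E) p).symm z) a)
      (frame p ((extChartAt 𝓘(ℝ, E) p).symm z) b) := rfl

omit [IsManifold 𝓘(ℝ, E) ∞ M] in
theorem symm_mem_source (hz : z ∈ (extChartAt 𝓘(ℝ, E) p).target) :
    (extChartAt 𝓘(ℝ, E) p).symm z ∈ (chartAt E p).source := by
  have := (extChartAt 𝓘(ℝ, E) p).map_target hz
  rwa [extChartAt_source] at this

theorem frame_chartJ (hz : z ∈ (extChartAt 𝓘(ℝ, E) p).target) (a : E) :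
    frame p ((extChartAt 𝓘(ℝ, E) p).symm z) (h.chartJ p z a)
      = h.J ((extChartAt 𝓘(ℝ, E) p).symm z) (frame p ((extChartAt 𝓘(ℝ, E) p).symm z) a) :=
  frame_coframe (symm_mem_source hz) _

theorem contDiffOn_chartMetric [FiniteDimensional ℝ E] :
    ContDiffOn ℝ ∞ (h.chartMetric p) (extChartAt 𝓘(ℝ, E) p).target := by
  refine contDiffOn_clm_apply.2 fun a ↦ contDiffOn_clm_apply.2 fun b ↦ ?_
  have key : CMDiff[(chartAt E p).source] ∞
      (fun x ↦ h.g.inner x (lift p (fun _ ↦ a) x) (lift p (fun _ ↦ b) x)) := by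
    intro x hx
    have := h.g.contMDiff.contMDiffAt (x := x) |>.clm_bundle_apply₂
      (E₃ := Bundle.Trivial M ℝ) (F₃ := ℝ) (contMDiffAt_lift_const hx a)
        (contMDiffAt_lift_const hx b)
    rw [contMDiffAt_totalSpace] at this
    exact this.2.contMDiffWithinAt
  exact (key.comp (contMDiffOn_extChartAt_symm p) fun z hz ↦ symm_mem_source hz).contDiffOn

theorem contDiffOn_chartJ [FiniteDimensional ℝ E] :
    ContDiffOn ℝ ∞ (h.chartJ p) (extChartAt 𝓘(ℝ, E) p).target := by
  refine contDiffOn_clm_apply.2 fun a ↦ ?_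
  have key : CMDiff[(chartAt E p).source] ∞
      (fun x ↦ coframe p x (h.J x (lift p (fun _ ↦ a) x))) := by
    intro x hx
    have := h.contMDiff_J.contMDiffAt (x := x) |>.clm_bundle_apply (contMDiffAt_lift_const hx a)
    exact ((contMDiffAt_section_iff (n := ⊤) hx).1 this).contMDiffWithinAt
  exact (key.comp (contMDiffOn_extChartAt_symm p) fun z hz ↦ symm_mem_source hz).contDiffOn

end AlmostHermitianStructure

/-! ### Covariant derivatives in a chart -/

namespace CovariantDerivative

open Bundle VectorField

variable {E : Type*} [NormedAddCommGroup E] [NormedSpace ℝ E] [FiniteDimensional ℝ E]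
  {M : Type*} [TopologicalSpace M] [ChartedSpace E M] [IsManifold 𝓘(ℝ, E) ∞ M]
  (cov : CovariantDerivative 𝓘(ℝ, E) E (fun x : M ↦ TangentSpace 𝓘(ℝ, E) x))

/-- The Christoffel symbols of a connection in the chart at `p`. -/
noncomputable def christoffel (p : M) (z : E) : E →L[ℝ] E →L[ℝ] E :=
  -- Expanding the second argument in a basis makes the symbol bilinear and continuous by
  -- construction; `apply_lift_const` recovers the usual meaning.
  ∑ i, (ContinuousLinearMap.smulRightL ℝ E E
      ((Module.finBasis ℝ E).coord i).toContinuousLinearMap).comp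
    ((coframe p ((extChartAt 𝓘(ℝ, E) p).symm z)).comp
      ((cov (lift p fun _ ↦ Module.finBasis ℝ E i) ((extChartAt 𝓘(ℝ, E) p).symm z)).comp
        (frame p ((extChartAt 𝓘(ℝ, E) p).symm z))))

variable {p x : M} {s : E → E}

theorem christoffel_apply (hx : x ∈ (chartAt E p).source) (a w : E) :
    cov.christoffel p (extChartAt 𝓘(ℝ, E) p x) a w = ∑ i, (Module.finBasis ℝ E).coord i w •
      coframe p x (cov (lift p fun _ ↦ Module.finBasis ℝ E i) x (frame p x a)) := by
  have hx' : x ∈ (extChartAt 𝓘(ℝ, E) p).source := by rwa [extChartAt_source]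
  rw [christoffel, (extChartAt 𝓘(ℝ, E) p).left_inv hx']
  simp

omit [FiniteDimensional ℝ E] in
theorem sum_apply {ι : Type*} (u : Finset ι) {σ : ι → Π x : M, TangentSpace 𝓘(ℝ, E) x}
    (hσ : ∀ i, MDiffAt (T% (σ i)) x) :
    cov (fun y ↦ ∑ i ∈ u, σ i y) x = ∑ i ∈ u, cov (σ i) x := by
  classical
  induction u using Finset.induction_on with
  | empty => exact congrFun cov.zero x
  | insert i u hi ih =>
    simp only [Finset.sum_insert hi, ← ih]
    exact cov.isCovariantDerivativeOnUniv.add (hσ i) (.sum_section fun i _ ↦ hσ i)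

/-- A covariant derivative in a chart. -/
theorem apply_lift (hx : x ∈ (chartAt E p).source)
    (hs : DifferentiableAt ℝ s (extChartAt 𝓘(ℝ, E) p x)) (a : E) :
    cov (lift p s) x (frame p x a)
      = frame p x (covD (cov.christoffel p) s (extChartAt 𝓘(ℝ, E) p x) a) := by
  set b := Module.finBasis ℝ E
  let c (i) : E →L[ℝ] ℝ := (b.coord i).toContinuousLinearMap
  have hx' : x ∈ (extChartAt 𝓘(ℝ, E) p).source := by rwa [extChartAt_source]
  let f (i) : M → ℝ := fun y ↦ c i (s (extChartAt 𝓘(ℝ, E) p y))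
  have hcs (i) : DifferentiableAt ℝ (fun z ↦ c i (s z)) (extChartAt 𝓘(ℝ, E) p x) :=
    (c i).differentiableAt.comp _ hs
  have hf (i) : MDiffAt (f i) x :=
    (hcs i).mdifferentiableAt.comp x (mdifferentiableAt_extChartAt hx)
  have hb (i) : MDiffAt (T% (lift p fun _ ↦ b i)) x :=
    mdifferentiableAt_lift hx (differentiableAt_const _)
  -- The Leibniz rule on this expansion in the basis fields gives `ds` from the coefficients and `Γ`
  -- from the fields.
  have e : lift p s = fun y ↦ ∑ i, (f i • lift p fun _ ↦ b i) y := by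
    funext y
    simp only [lift, Pi.smul_apply']
    conv_lhs => rw [← b.sum_repr (s (extChartAt 𝓘(ℝ, E) p y)), map_sum]
    exact Finset.sum_congr rfl fun i _ ↦ map_smul _ _ _
  have hd (i) : mvfderiv 𝓘(ℝ, E) (f i) x (frame p x a)
      = c i (fderiv ℝ s (extChartAt 𝓘(ℝ, E) p x) a) := by
    rw [mvfderiv_frame hx (hf i)]
    have e : f i ∘ (extChartAt 𝓘(ℝ, E) p).symm =ᶠ[nhds (extChartAt 𝓘(ℝ, E) p x)]
        fun z ↦ c i (s z) := by
      filter_upwards [(isOpen_extChartAt_target p).mem_nhds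
        ((extChartAt 𝓘(ℝ, E) p).map_source hx')] with z hz
      simp only [f, Function.comp_apply, (extChartAt 𝓘(ℝ, E) p).right_inv hz]
    rw [e.fderiv_eq]
    exact IsLocalAlmostHermitian.fderiv_comp_apply (c i).differentiableAt hs a |>.trans (by simp)
  rw [e, cov.sum_apply _ fun i ↦ (hf i).smul_section (hb i)]
  have hl (i) := cov.isCovariantDerivativeOnUniv.leibniz (hb i) (hf i)
  simp only [hl, covD, christoffel_apply _ hx]
  rw [map_add, map_sum]
  simp only [map_smul, frame_coframe hx]
  conv_rhs => enter [1]; rw [← b.sum_repr (fderiv ℝ s (extChartAt 𝓘(ℝ, E) p x) a), map_sum]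
  rw [← Finset.sum_add_distrib, _root_.sum_apply]
  refine Finset.sum_congr rfl fun i _ ↦ ?_
  simp only [add_apply, smul_apply, ContinuousLinearMap.smulRight_apply, map_smul, hd]
  rw [add_comm]
  rfl

theorem apply_lift_const (hx : x ∈ (chartAt E p).source) (w a : E) :
    cov (lift p fun _ ↦ w) x (frame p x a)
      = frame p x (cov.christoffel p (extChartAt 𝓘(ℝ, E) p x) a w) := by
  rw [cov.apply_lift hx (differentiableAt_const w)]
  simp [covD]

end CovariantDerivative

/-! ### The canonical connection and its curvature in a chart -/

namespace AlmostHermitianStructure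

open Bundle VectorField

variable {E : Type*} [NormedAddCommGroup E] [NormedSpace ℝ E] [FiniteDimensional ℝ E]
  {M : Type*} [TopologicalSpace M] [ChartedSpace E M] [IsManifold 𝓘(ℝ, E) ∞ M]
  {h : AlmostHermitianStructure E M} {p x : M} {z : E}

omit [FiniteDimensional ℝ E] in
theorem frame_injective (hx : x ∈ (chartAt E p).source) : Function.Injective (frame (E := E) p x) :=
  Function.LeftInverse.injective (g := coframe p x) (coframe_frame hx)

theorem fderiv_chartMetric (hz : z ∈ (extChartAt 𝓘(ℝ, E) p).target) (a b c : E) :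
    fderiv ℝ (h.chartMetric p) z a b c
      = h.chartMetric p z (h.canonicalConnection.christoffel p z a b) c
        + h.chartMetric p z b (h.canonicalConnection.christoffel p z a c) := by
  have hx := symm_mem_source hz
  set x := (extChartAt 𝓘(ℝ, E) p).symm z with hxdef
  have hφx : extChartAt 𝓘(ℝ, E) p x = z := (extChartAt 𝓘(ℝ, E) p).right_inv hz
  have hl (w : E) : MDiffAt (T% (lift p fun _ ↦ w)) x :=
    mdifferentiableAt_lift hx (differentiableAt_const _)
  have hd : DifferentiableAt ℝ (h.chartMetric p) z :=
    ((contDiffOn_chartMetric z hz).contDiffAt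
      ((isOpen_extChartAt_target p).mem_nhds hz)).differentiableAt (by simp)
  have e1 : fderiv ℝ (fun z ↦ h.chartMetric p z b c) z a = fderiv ℝ (h.chartMetric p) z a b c := by
    rw [((hd.hasFDerivAt.clm_apply (hasFDerivAt_const b z)).clm_apply
      (hasFDerivAt_const c z)).fderiv]
    simp
  have e2 := mvfderiv_frame hx (mdifferentiableAt_gField (h := h) (hl b) (hl c)) a
  rw [h.isCanonicalConnection_canonicalConnection.metric _ _ x (hl b) (hl c),
    CovariantDerivative.apply_lift_const _ hx, CovariantDerivative.apply_lift_const _ hx, hφx] at e2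
  rw [← e1]
  exact e2.symm

theorem fderiv_chartJ (hz : z ∈ (extChartAt 𝓘(ℝ, E) p).target) (a b : E) :
    fderiv ℝ (h.chartJ p) z a b
      = h.chartJ p z (h.canonicalConnection.christoffel p z a b)
        - h.canonicalConnection.christoffel p z a (h.chartJ p z b) := by
  have hx := symm_mem_source hz
  have hfJ := frame_chartJ (h := h) hz
  set x := (extChartAt 𝓘(ℝ, E) p).symm z with hxdef
  have hφx : extChartAt 𝓘(ℝ, E) p x = z := (extChartAt 𝓘(ℝ, E) p).right_inv hz
  have hl (w : E) : MDiffAt (T% (lift p fun _ ↦ w)) x :=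
    mdifferentiableAt_lift hx (differentiableAt_const _)
  have hd : DifferentiableAt ℝ (h.chartJ p) z :=
    ((contDiffOn_chartJ z hz).contDiffAt
      ((isOpen_extChartAt_target p).mem_nhds hz)).differentiableAt (by simp)
  have hdb : DifferentiableAt ℝ (fun z ↦ h.chartJ p z b) (extChartAt 𝓘(ℝ, E) p x) := by
    rw [hφx]; exact hd.clm_apply (differentiableAt_const b)
  have heq : ∀ᶠ y in nhds x,
      h.JField (lift p fun _ ↦ b) y = lift p (fun z ↦ h.chartJ p z b) y := by
    filter_upwards [(chartAt E p).open_source.mem_nhds hx] with y hy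
    have hy' : y ∈ (extChartAt 𝓘(ℝ, E) p).source := by rwa [extChartAt_source]
    have := frame_chartJ (h := h) ((extChartAt 𝓘(ℝ, E) p).map_source hy') b
    rw [(extChartAt 𝓘(ℝ, E) p).left_inv hy'] at this
    exact this.symm
  have e1 : fderiv ℝ (fun z ↦ h.chartJ p z b) z a = fderiv ℝ (h.chartJ p) z a b := by
    rw [(hd.hasFDerivAt.clm_apply (hasFDerivAt_const b z)).fderiv]
    simp
  have e2 := h.isCanonicalConnection_canonicalConnection.complex _ x (hl b) (frame p x a)
  -- `J` of a coordinate field agrees with a lifted field only near `x`, so the locality of the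
  -- connection is used.
  rw [h.canonicalConnection.isCovariantDerivativeOnUniv.congr_of_eventuallyEq
    (mdifferentiableAt_JField (hl b)) (mdifferentiableAt_lift hx hdb) Filter.univ_mem heq,
    CovariantDerivative.apply_lift _ hx hdb, CovariantDerivative.apply_lift_const _ hx, hφx,
    ← hfJ] at e2
  have e3 := frame_injective hx e2
  rw [covD, e1] at e3
  exact eq_sub_of_add_eq e3

/-- Coordinate fields commute, so their torsion is the antisymmetric part of the Christoffel
symbols. -/
theorem christoffel_torsion (hz : z ∈ (extChartAt 𝓘(ℝ, E) p).target) (a b : E) :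
    h.canonicalConnection.christoffel p z a b - h.canonicalConnection.christoffel p z b a
      + (h.canonicalConnection.christoffel p z (h.chartJ p z a) (h.chartJ p z b)
      - h.canonicalConnection.christoffel p z (h.chartJ p z b) (h.chartJ p z a)) = 0 := by
  have hx := symm_mem_source hz
  have hfJ := frame_chartJ (h := h) hz
  set x := (extChartAt 𝓘(ℝ, E) p).symm z with hxdef
  have hφx : extChartAt 𝓘(ℝ, E) p x = z := (extChartAt 𝓘(ℝ, E) p).right_inv hz
  have : CompleteSpace E := FiniteDimensional.complete ℝ E
  have ht (a b : E) : h.canonicalConnection.torsion x (frame p x a) (frame p x b)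
      = frame p x (h.canonicalConnection.christoffel p z a b
        - h.canonicalConnection.christoffel p z b a) := by
    have hl (w : E) : MDiffAt (T% (lift p fun _ ↦ w)) x :=
      mdifferentiableAt_lift hx (differentiableAt_const _)
    have := h.canonicalConnection.torsion_apply (hl a) (hl b)
    rw [mlieBracket_lift_const hx, sub_zero] at this
    refine this.trans ?_
    rw [map_sub]
    have e1 := CovariantDerivative.apply_lift_const h.canonicalConnection hx b a
    have e2 := CovariantDerivative.apply_lift_const h.canonicalConnection hx a b
    rw [hφx] at e1 e2
    exact congrArg₂ _ e1 e2
  have e := h.isCanonicalConnection_canonicalConnection.torsion x (frame p x a) (frame p x b)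
  rw [← hfJ, ← hfJ, ht, ht, ← map_add] at e
  exact frame_injective hx (e.trans (map_zero _).symm)

variable (h p) in
theorem isLocalAlmostHermitian : IsLocalAlmostHermitian (extChartAt 𝓘(ℝ, E) p).target
    (h.chartMetric p) (h.chartJ p) (h.canonicalConnection.christoffel p) where
  isOpen := isOpen_extChartAt_target p
  contDiffOn_G := contDiffOn_chartMetric
  contDiffOn_J := contDiffOn_chartJ
  symm z _ a b := h.g.symm _ _ _
  pos z hz a ha := h.g.pos _ _ fun h0 ↦
    ha (frame_injective (symm_mem_source hz) (h0.trans (map_zero _).symm))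
  J_J z hz a := by
    apply frame_injective (symm_mem_source hz)
    rw [frame_chartJ hz, frame_chartJ hz, h.J_J, map_neg]
  G_J_J z hz a b := by
    rw [chartMetric_symm_apply, frame_chartJ hz, frame_chartJ hz, h.g_J_J]
    rfl
  metric z hz := fderiv_chartMetric hz
  complex z hz := fderiv_chartJ hz
  torsion z hz := christoffel_torsion hz

-- The curvature is defined through `FiberBundle.extend`. In the chart at `p` this extension has
-- constant coefficients, so it is a lifted constant field on the whole chart domain.
omit [FiniteDimensional ℝ E] in
theorem extend_frame_apply (hx : x ∈ (chartAt E p).source) (w : E) :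
    FiberBundle.extend E (frame p p w) x = lift p (fun _ ↦ w) x := by
  have hp : p ∈ (chartAt E p).source := mem_chart_source E p
  have hx' : x ∈ (trivializationAt E (TangentSpace 𝓘(ℝ, E)) p).baseSet := hx
  simp only [FiberBundle.extend]
  rw [snd_trivializationAt hp, coframe_frame hp, lift, frame, Trivialization.symmL_apply _ hx']

omit [FiniteDimensional ℝ E] in
theorem extend_frame_eventuallyEq (hx : x ∈ (chartAt E p).source) (w : E) :
    (FiberBundle.extend E (frame p p w) : Π x : M, TangentSpace 𝓘(ℝ, E) x)
      =ᶠ[nhds x] lift p fun _ ↦ w := by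
  filter_upwards [(chartAt E p).open_source.mem_nhds hx] with y hy using extend_frame_apply hy w

omit [FiniteDimensional ℝ E] in
theorem apply_eq_of_eventuallyEq
    {cov : CovariantDerivative 𝓘(ℝ, E) E (fun x : M ↦ TangentSpace 𝓘(ℝ, E) x)}
    {σ τ : Π x : M, TangentSpace 𝓘(ℝ, E) x} (hτ : MDiffAt (T% τ) x) (e : σ =ᶠ[nhds x] τ) :
    cov σ x = cov τ x := by
  have hσ : MDiffAt (T% σ) x := by
    refine hτ.congr_of_eventuallyEq ?_
    filter_upwards [e] with y hy
    rw [hy]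
  exact cov.isCovariantDerivativeOnUniv.congr_of_eventuallyEq hσ hτ Filter.univ_mem e

/-- The curvature of the canonical connection in terms of its Christoffel symbols. -/
theorem curvature_frame (u v w : E) : h.curvature p (frame p p u) (frame p p v) (frame p p w)
    = frame p p (curv (h.canonicalConnection.christoffel p) (extChartAt 𝓘(ℝ, E) p p) u v w) := by
  have : CompleteSpace E := FiniteDimensional.complete ℝ E
  have hp : p ∈ (chartAt E p).source := mem_chart_source E p
  have hL := h.isLocalAlmostHermitian p
  have hz := mem_extChartAt_target (I := 𝓘(ℝ, E)) p
  have hΓ := hL.differentiableAt_Γ hz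
  have second (u v : E) : h.canonicalConnection (fun y ↦ h.canonicalConnection
      (FiberBundle.extend E (frame p p w)) y (FiberBundle.extend E (frame p p v) y)) p
      (frame p p u) = frame p p
        (fderiv ℝ (h.canonicalConnection.christoffel p) (extChartAt 𝓘(ℝ, E) p p) u v w
        + h.canonicalConnection.christoffel p (extChartAt 𝓘(ℝ, E) p p) u
          (h.canonicalConnection.christoffel p (extChartAt 𝓘(ℝ, E) p p) v w)) := by
    have heq : (fun y ↦ h.canonicalConnection (FiberBundle.extend E (frame p p w)) y
        (FiberBundle.extend E (frame p p v) y)) =ᶠ[nhds p]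
        lift p (fun z ↦ h.canonicalConnection.christoffel p z v w) := by
      filter_upwards [(chartAt E p).open_source.mem_nhds hp] with y hy
      rw [apply_eq_of_eventuallyEq (mdifferentiableAt_lift hy (differentiableAt_const w))
        (extend_frame_eventuallyEq hy w), extend_frame_apply hy]
      exact CovariantDerivative.apply_lift_const _ hy w v
    have hd : DifferentiableAt ℝ (fun z ↦ h.canonicalConnection.christoffel p z v w)
        (extChartAt 𝓘(ℝ, E) p p) :=
      (hΓ.clm_apply (differentiableAt_const v)).clm_apply (differentiableAt_const w)
    rw [apply_eq_of_eventuallyEq (mdifferentiableAt_lift hp hd) heq,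
      CovariantDerivative.apply_lift _ hp hd, covD,
      ((hΓ.hasFDerivAt.clm_apply (hasFDerivAt_const v _)).clm_apply (hasFDerivAt_const w _)).fderiv]
    simp only [add_apply, ContinuousLinearMap.comp_apply, ContinuousLinearMap.flip_apply,
      zero_apply, map_zero, zero_add]
  have e (w : E) : FiberBundle.extend E (frame p p w) p = frame p p w := extend_frame_apply hp w
  have hb : mlieBracket 𝓘(ℝ, E) (FiberBundle.extend E (frame p p u))
      (FiberBundle.extend E (frame p p v)) p = 0 :=
    ((extend_frame_eventuallyEq hp u).mlieBracket_vectorField_eq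
      (extend_frame_eventuallyEq hp v)).trans (mlieBracket_lift_const hp u v)
  rw [curvature, curvatureField, hb, map_zero, sub_zero,
    e u, e v, second, second, ← map_sub]
  congr 1
  simp only [curv]
  abel

end AlmostHermitianStructure

/-- Used to shrink the chart at `p` to the part that `f` maps into the chart at `f p`. -/
theorem IsLocalAlmostHermitian.mono {E : Type*} [NormedAddCommGroup E] [NormedSpace ℝ E]
    {U V : Set E} {G : E → E →L[ℝ] E →L[ℝ] ℝ} {J : E → E →L[ℝ] E} {Γ : E → E →L[ℝ] E →L[ℝ] E}
    (h : IsLocalAlmostHermitian U G J Γ) (hV : IsOpen V) (hVU : V ⊆ U) :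
    IsLocalAlmostHermitian V G J Γ where
  isOpen := hV
  contDiffOn_G := h.contDiffOn_G.mono hVU
  contDiffOn_J := h.contDiffOn_J.mono hVU
  symm y hy := h.symm y (hVU hy)
  pos y hy := h.pos y (hVU hy)
  J_J y hy := h.J_J y (hVU hy)
  G_J_J y hy := h.G_J_J y (hVU hy)
  metric y hy := h.metric y (hVU hy)
  complex y hy := h.complex y (hVU hy)
  torsion y hy := h.torsion y (hVU hy)

/-! ### Maps in charts -/

namespace TangentChart

variable {E : Type*} [NormedAddCommGroup E] [NormedSpace ℝ E]
  {M : Type*} [TopologicalSpace M] [ChartedSpace E M] [IsManifold 𝓘(ℝ, E) ∞ M]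
  {E' : Type*} [NormedAddCommGroup E'] [NormedSpace ℝ E']
  {N : Type*} [TopologicalSpace N] [ChartedSpace E' N] [IsManifold 𝓘(ℝ, E') ∞ N]
  {f : M → N}

/-- The expression of `f` in the charts at `p` and `q`. -/
noncomputable def chartMap (f : M → N) (p : M) (q : N) : E → E' :=
  (extChartAt 𝓘(ℝ, E') q ∘ f) ∘ (extChartAt 𝓘(ℝ, E) p).symm

/-- The set where the expression of `f` in the charts at `p` and `q` is meaningful. -/
def chartMapDomain (E E' : Type*) [NormedAddCommGroup E] [NormedSpace ℝ E] [ChartedSpace E M]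
    [NormedAddCommGroup E'] [NormedSpace ℝ E'] [ChartedSpace E' N] (f : M → N) (p : M) (q : N) :
    Set E :=
  (extChartAt 𝓘(ℝ, E) p).target ∩
    (extChartAt 𝓘(ℝ, E) p).symm ⁻¹' (f ⁻¹' (chartAt E' q).source)

variable {p : M} {q : N} {z : E}

omit [IsManifold 𝓘(ℝ, E) ∞ M] [IsManifold 𝓘(ℝ, E') ∞ N] in
theorem isOpen_chartMapDomain (hf : Continuous f) : IsOpen (chartMapDomain E E' f p q) :=
  (continuousOn_extChartAt_symm p).isOpen_inter_preimage (isOpen_extChartAt_target p)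
    ((chartAt E' q).open_source.preimage hf)

omit [IsManifold 𝓘(ℝ, E) ∞ M] [IsManifold 𝓘(ℝ, E') ∞ N] in
theorem mem_chartMapDomain : extChartAt 𝓘(ℝ, E) p p ∈ chartMapDomain E E' f p (f p) := by
  refine ⟨mem_extChartAt_target p, ?_⟩
  rw [Set.mem_preimage, extChartAt_to_inv]
  exact mem_chart_source E' (f p)

omit [IsManifold 𝓘(ℝ, E) ∞ M] [IsManifold 𝓘(ℝ, E') ∞ N] in
theorem mapsTo_chartMap :
    Set.MapsTo (chartMap f p q) (chartMapDomain E E' f p q) (extChartAt 𝓘(ℝ, E') q).target := by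
  intro z hz
  refine (extChartAt 𝓘(ℝ, E') q).map_source ?_
  rw [extChartAt_source]
  exact hz.2

omit [IsManifold 𝓘(ℝ, E) ∞ M] [IsManifold 𝓘(ℝ, E') ∞ N] in
theorem symm_chartMap (hz : z ∈ chartMapDomain E E' f p q) :
    (extChartAt 𝓘(ℝ, E') q).symm (chartMap f p q z) = f ((extChartAt 𝓘(ℝ, E) p).symm z) := by
  refine (extChartAt 𝓘(ℝ, E') q).left_inv ?_
  rw [extChartAt_source]
  exact hz.2

theorem contDiffOn_chartMap (hf : ContMDiff 𝓘(ℝ, E) 𝓘(ℝ, E') ∞ f) :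
    ContDiffOn ℝ ∞ (chartMap f p q : E → E') (chartMapDomain E E' f p q) := by
  have h1 : CMDiff[f ⁻¹' (chartAt E' q).source] ∞ (extChartAt 𝓘(ℝ, E') q ∘ f) :=
    (contMDiffOn_extChartAt (x := q)).comp hf.contMDiffOn fun x hx ↦ hx
  exact (h1.comp ((contMDiffOn_extChartAt_symm p).mono Set.inter_subset_left)
    fun z hz ↦ hz.2).contDiffOn

theorem fderiv_chartMap (hf : ContMDiff 𝓘(ℝ, E) 𝓘(ℝ, E') ∞ f)
    (hz : z ∈ chartMapDomain E E' f p q) (a : E) :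
    fderiv ℝ (chartMap f p q) z a = coframe q (f ((extChartAt 𝓘(ℝ, E) p).symm z))
      (mfderiv 𝓘(ℝ, E) 𝓘(ℝ, E') f ((extChartAt 𝓘(ℝ, E) p).symm z)
        (frame p ((extChartAt 𝓘(ℝ, E) p).symm z) a)) := by
  have hx := AlmostHermitianStructure.symm_mem_source hz.1
  have hfx : f ((extChartAt 𝓘(ℝ, E) p).symm z) ∈ (chartAt E' q).source := hz.2
  have hφx := (extChartAt 𝓘(ℝ, E) p).right_inv hz.1
  set x := (extChartAt 𝓘(ℝ, E) p).symm z
  have hfd : MDiffAt f x := hf.contMDiffAt.mdifferentiableAt (by simp)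
  have h1 : MDiffAt (extChartAt 𝓘(ℝ, E') q ∘ f) x :=
    (mdifferentiableAt_extChartAt hfx).comp x hfd
  have h2 := mvfderiv_frame hx h1 a
  rw [hφx] at h2
  have h3 := mfderiv_comp_apply x (mdifferentiableAt_extChartAt hfx) hfd (frame p x a)
  rw [← coframe_eq hfx] at h3
  exact h2.symm.trans h3

end TangentChart

/-! ### The maximum of `|df v|² / |v|²` and the vanishing of `df` -/

namespace AlmostHermitianStructure

variable {E : Type*} [NormedAddCommGroup E] [NormedSpace ℝ E] [FiniteDimensional ℝ E]
  {M : Type*} [TopologicalSpace M] [ChartedSpace E M] [IsManifold 𝓘(ℝ, E) ∞ M]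
  {E' : Type*} [NormedAddCommGroup E'] [NormedSpace ℝ E'] [FiniteDimensional ℝ E']
  {N : Type*} [TopologicalSpace N] [ChartedSpace E' N] [IsManifold 𝓘(ℝ, E') ∞ N]
  {h : AlmostHermitianStructure E M} {h' : AlmostHermitianStructure E' N}
  {f : M → N} {p : M} {q : N} {z : E}

/-- The norm squared of `df v`. -/
noncomputable def pullbackNormSq (h' : AlmostHermitianStructure E' N) (f : M → N) (x : M)
    (v : TangentSpace 𝓘(ℝ, E) x) : ℝ :=
  h'.g.inner (f x) (mfderiv 𝓘(ℝ, E) 𝓘(ℝ, E') f x v) (mfderiv 𝓘(ℝ, E) 𝓘(ℝ, E') f x v)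

omit [FiniteDimensional ℝ E] [FiniteDimensional ℝ E'] in
theorem frame_fderiv_chartMap (hf : ContMDiff 𝓘(ℝ, E) 𝓘(ℝ, E') ∞ f)
    (hz : z ∈ chartMapDomain E E' f p q) (a : E) :
    frame q (f ((extChartAt 𝓘(ℝ, E) p).symm z)) (fderiv ℝ (chartMap f p q) z a)
      = mfderiv 𝓘(ℝ, E) 𝓘(ℝ, E') f ((extChartAt 𝓘(ℝ, E) p).symm z)
        (frame p ((extChartAt 𝓘(ℝ, E) p).symm z) a) := by
  rw [fderiv_chartMap hf hz, frame_coframe hz.2]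

omit [FiniteDimensional ℝ E] [FiniteDimensional ℝ E'] in
theorem chartMetric_fderiv_chartMap (hf : ContMDiff 𝓘(ℝ, E) 𝓘(ℝ, E') ∞ f)
    (hz : z ∈ chartMapDomain E E' f p q) (a : E) :
    h'.chartMetric q (chartMap f p q z) (fderiv ℝ (chartMap f p q) z a)
      (fderiv ℝ (chartMap f p q) z a) = h'.pullbackNormSq f ((extChartAt 𝓘(ℝ, E) p).symm z)
        (frame p ((extChartAt 𝓘(ℝ, E) p).symm z) a) := by
  rw [chartMetric_symm_apply, symm_chartMap hz, frame_fderiv_chartMap hf hz]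
  rfl

omit [FiniteDimensional ℝ E] [FiniteDimensional ℝ E'] in
theorem fderiv_chartMap_chartJ (hf : h.IsAlmostHolomorphic h' f)
    (hz : z ∈ chartMapDomain E E' f p q) (a : E) :
    fderiv ℝ (chartMap f p q) z (h.chartJ p z a)
      = h'.chartJ q (chartMap f p q z) (fderiv ℝ (chartMap f p q) z a) := by
  apply frame_injective (p := q) (x := f ((extChartAt 𝓘(ℝ, E) p).symm z)) hz.2
  have e := frame_chartJ (h := h') (mapsTo_chartMap hz) (fderiv ℝ (chartMap f p q) z a)
  rw [symm_chartMap hz, frame_fderiv_chartMap hf.1 hz] at e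
  rw [e, frame_fderiv_chartMap hf.1 hz, frame_chartJ hz.1, hf.2]

/-- The comparison of the holomorphic sectional curvatures at a direction where
`df` has maximal norm. -/
theorem curvature_le_of_isMax (hf : h.IsAlmostHolomorphic h' f) {l : ℝ}
    (hmax : ∀ x v, h'.pullbackNormSq f x v ≤ l * h.g.inner x v v)
    {v : TangentSpace 𝓘(ℝ, E) p} (heq : h'.pullbackNormSq f p v = l * h.g.inner p v v) :
    l * h.g.inner p (h.curvature p v (h.J p v) (h.J p v)) v ≤
      h'.g.inner (f p) (h'.curvature (f p) (mfderiv 𝓘(ℝ, E) 𝓘(ℝ, E') f p v)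
        (h'.J (f p) (mfderiv 𝓘(ℝ, E) 𝓘(ℝ, E') f p v))
        (h'.J (f p) (mfderiv 𝓘(ℝ, E) 𝓘(ℝ, E') f p v))) (mfderiv 𝓘(ℝ, E) 𝓘(ℝ, E') f p v) := by
  have hp : p ∈ (chartAt E p).source := mem_chart_source E p
  have hz : extChartAt 𝓘(ℝ, E) p p ∈ chartMapDomain E E' f p (f p) := mem_chartMapDomain
  obtain ⟨a, rfl⟩ : ∃ a, frame p p a = v := ⟨_, frame_coframe hp v⟩
  have hF : chartMap f p (f p) (extChartAt 𝓘(ℝ, E) p p) = extChartAt 𝓘(ℝ, E') (f p) (f p) := by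
    simp only [chartMap, Function.comp_apply, extChartAt_to_inv]
  have e1 := frame_chartJ (h := h) hz.1 a
  have e2 := frame_fderiv_chartMap hf.1 hz a
  have e3 := frame_chartJ (h := h') (mapsTo_chartMap hz)
    (fderiv ℝ (chartMap f p (f p)) (extChartAt 𝓘(ℝ, E) p p) a)
  have e4 := chartMetric_fderiv_chartMap (h' := h') hf.1 hz a
  have e5 (b c : E) : h.chartMetric p (extChartAt 𝓘(ℝ, E) p p) b c
      = h.g.inner p (frame p p b) (frame p p c) := by
    rw [chartMetric_symm_apply, extChartAt_to_inv]
  have e6 (b c : E') : h'.chartMetric (f p) (extChartAt 𝓘(ℝ, E') (f p) (f p)) b c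
      = h'.g.inner (f p) (frame (f p) (f p) b) (frame (f p) (f p) c) := by
    rw [chartMetric_symm_apply, extChartAt_to_inv]
  rw [extChartAt_to_inv] at e1 e2 e4
  rw [hF, extChartAt_to_inv, e2] at e3
  have key := IsLocalAlmostHermitian.curv_le_of_isMax
    ((h.isLocalAlmostHermitian p).mono (isOpen_chartMapDomain hf.1.continuous)
      Set.inter_subset_left) (h'.isLocalAlmostHermitian (f p)) (contDiffOn_chartMap hf.1)
    mapsTo_chartMap (fun y hy ↦ fderiv_chartMap_chartJ hf hy) (l := l) (v := a) hz
    (fun y hy b ↦ by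
      rw [chartMetric_fderiv_chartMap hf.1 hy, chartMetric_symm_apply]
      exact hmax _ _) (by rw [e4, e5]; exact heq)
  rw [hF, e5, e6, ← curvature_frame, ← curvature_frame, e1, e2, e3] at key
  exact key

/-- The values of `|df v|² / |v|²` at the points of a small set lie in a compact set of such
values. -/
theorem exists_isCompact_ratio_nhds (h : AlmostHermitianStructure E M)
    (h' : AlmostHermitianStructure E' N) (hf : ContMDiff 𝓘(ℝ, E) 𝓘(ℝ, E') ∞ f) (p : M) :
    ∃ A ∈ nhds p, ∃ T : Set ℝ, IsCompact T ∧
      (∀ x ∈ A, ∀ v : TangentSpace 𝓘(ℝ, E) x, v ≠ 0 →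
        h'.pullbackNormSq f x v / h.g.inner x v v ∈ T) ∧
      ∀ t ∈ T, ∃ (x : M) (v : TangentSpace 𝓘(ℝ, E) x), v ≠ 0 ∧
        h'.pullbackNormSq f x v / h.g.inner x v v = t := by
  have : ProperSpace E := FiniteDimensional.proper ℝ E
  let U := chartMapDomain E E' f p (f p)
  let F : E → E' := chartMap f p (f p)
  have hU : IsOpen U := isOpen_chartMapDomain hf.continuous
  have hF : ContDiffOn ℝ ∞ F U := contDiffOn_chartMap hf
  obtain ⟨K, hK, hKU, hKc⟩ := local_compact_nhds (hU.mem_nhds mem_chartMapDomain)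
  let r : E × E → ℝ := fun y ↦ h'.chartMetric (f p) (F y.1) (fderiv ℝ F y.1 y.2)
    (fderiv ℝ F y.1 y.2) / h.chartMetric p y.1 y.2 y.2
  have hr (z : E) (hz : z ∈ K) (a : E) : r (z, a) = h'.pullbackNormSq f
      ((extChartAt 𝓘(ℝ, E) p).symm z) (frame p ((extChartAt 𝓘(ℝ, E) p).symm z) a)
      / h.g.inner ((extChartAt 𝓘(ℝ, E) p).symm z) (frame p ((extChartAt 𝓘(ℝ, E) p).symm z) a)
        (frame p ((extChartAt 𝓘(ℝ, E) p).symm z) a) := by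
    simp only [r, F]
    rw [chartMetric_fderiv_chartMap hf (hKU hz), chartMetric_symm_apply]
  have hrs (z a : E) (c : ℝ) (hc : c ≠ 0) : r (z, c • a) = r (z, a) := by
    simp only [r, map_smul, smul_apply, smul_eq_mul]
    rw [mul_div_mul_left _ _ hc, mul_div_mul_left _ _ hc]
  have hfr (z : E) (hz : z ∈ K) (a : E) (ha : a ≠ 0) :
      frame p ((extChartAt 𝓘(ℝ, E) p).symm z) a ≠ 0 := fun h0 ↦
    ha (frame_injective (symm_mem_source (hKU hz).1) (h0.trans (map_zero _).symm))
  have hcont : ContinuousOn r (K ×ˢ Metric.sphere 0 1) := by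
    have m1 : Set.MapsTo Prod.fst (K ×ˢ Metric.sphere (0 : E) 1) U := fun y hy ↦ hKU hy.1
    have m2 : Set.MapsTo Prod.fst (K ×ˢ Metric.sphere (0 : E) 1)
      (extChartAt 𝓘(ℝ, E) p).target := fun y hy ↦ (hKU hy.1).1
    have c1 : ContinuousOn (fun y : E × E ↦ fderiv ℝ F y.1 y.2) (K ×ˢ Metric.sphere 0 1) :=
      (((hF.fderiv_of_isOpen (m := ∞) hU (by simp)).continuousOn).comp continuousOn_fst m1).clm_apply
        continuousOn_snd
    have c2 : ContinuousOn (fun y : E × E ↦ h'.chartMetric (f p) (F y.1))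
        (K ×ˢ Metric.sphere 0 1) :=
      (contDiffOn_chartMetric.continuousOn.comp hF.continuousOn mapsTo_chartMap).comp
        continuousOn_fst m1
    have c3 : ContinuousOn (fun y : E × E ↦ h.chartMetric p y.1) (K ×ˢ Metric.sphere 0 1) :=
      contDiffOn_chartMetric.continuousOn.comp continuousOn_fst m2
    refine ((c2.clm_apply c1).clm_apply c1).div
      ((c3.clm_apply continuousOn_snd).clm_apply continuousOn_snd) fun y hy ↦ ?_
    exact (h.g.pos _ _ (hfr y.1 hy.1 y.2 (ne_zero_of_mem_unit_sphere ⟨y.2, hy.2⟩))).ne'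
  -- The set `T` is the image of `K` times the unit sphere for the norm of `E`. This sphere need not
  -- be a sphere for the metric, which is harmless because the ratio is homogeneous of degree zero.
  refine ⟨(extChartAt 𝓘(ℝ, E) p).source ∩ extChartAt 𝓘(ℝ, E) p ⁻¹' K,
    Filter.inter_mem (extChartAt_source_mem_nhds p) ((continuousAt_extChartAt p).preimage_mem_nhds hK),
    r '' (K ×ˢ Metric.sphere 0 1), (hKc.prod (isCompact_sphere 0 1)).image_of_continuousOn hcont,
    ?_, ?_⟩
  · intro x hx v hv
    obtain ⟨z, hz, rfl⟩ : ∃ z ∈ K, (extChartAt 𝓘(ℝ, E) p).symm z = x :=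
      ⟨_, hx.2, (extChartAt 𝓘(ℝ, E) p).left_inv hx.1⟩
    obtain ⟨a, rfl⟩ := (⟨_, frame_coframe (symm_mem_source (hKU hz).1) v⟩ :
      ∃ a, frame p ((extChartAt 𝓘(ℝ, E) p).symm z) a = v)
    have ha : a ≠ 0 := by
      rintro rfl
      exact hv (map_zero _)
    refine ⟨(z, ‖a‖⁻¹ • a), ⟨hz, ?_⟩, ?_⟩
    · simpa using norm_smul_inv_norm (𝕜 := ℝ) ha
    · rw [hrs _ _ _ (inv_ne_zero (norm_ne_zero_iff.2 ha)), hr z hz]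
  · rintro _ ⟨⟨z, a⟩, ⟨hz, ha⟩, rfl⟩
    exact ⟨_, _, hfr z hz a (ne_zero_of_mem_unit_sphere ⟨a, ha⟩), (hr z hz a).symm⟩

/-- Compactness induction over `M` joins the local sets `T`. Each of them consists of actual ratios,
so their finite union is exactly the set of all ratios, and its maximum is attained; the unit sphere
bundle is not needed. -/
theorem exists_isCompact_ratio [CompactSpace M] (h : AlmostHermitianStructure E M)
    (h' : AlmostHermitianStructure E' N) (hf : ContMDiff 𝓘(ℝ, E) 𝓘(ℝ, E') ∞ f) :
    IsCompact {t | ∃ (x : M) (v : TangentSpace 𝓘(ℝ, E) x), v ≠ 0 ∧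
        h'.pullbackNormSq f x v / h.g.inner x v v = t} := by
  obtain ⟨T, hT, h1, h2⟩ : ∃ T : Set ℝ, IsCompact T ∧
      (∀ x ∈ (Set.univ : Set M), ∀ v : TangentSpace 𝓘(ℝ, E) x, v ≠ 0 →
        h'.pullbackNormSq f x v / h.g.inner x v v ∈ T) ∧
      ∀ t ∈ T, ∃ (x : M) (v : TangentSpace 𝓘(ℝ, E) x), v ≠ 0 ∧
        h'.pullbackNormSq f x v / h.g.inner x v v = t := by
    refine isCompact_univ.induction_on ⟨∅, isCompact_empty, by simp, by simp⟩ ?_ ?_ ?_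
    · rintro A B hAB ⟨T, hT, h1, h2⟩
      exact ⟨T, hT, fun x hx ↦ h1 x (hAB hx), h2⟩
    · rintro A B ⟨T, hT, h1, h2⟩ ⟨S, hS, h3, h4⟩
      refine ⟨T ∪ S, hT.union hS, ?_, ?_⟩
      · rintro x (hx | hx) v hv
        exacts [.inl (h1 x hx v hv), .inr (h3 x hx v hv)]
      · rintro t (ht | ht)
        exacts [h2 t ht, h4 t ht]
    · intro x _
      rw [nhdsWithin_univ]
      exact exists_isCompact_ratio_nhds h h' hf x
  convert hT using 1
  ext t
  refine ⟨?_, h2 t⟩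
  rintro ⟨x, v, hv, rfl⟩
  exact h1 x trivial v hv

/-- The number `l` is the greatest ratio; it is positive because the ratio at `v₀` is. -/
theorem exists_max_pullbackNormSq [CompactSpace M] (h : AlmostHermitianStructure E M)
    (h' : AlmostHermitianStructure E' N) (hf : ContMDiff 𝓘(ℝ, E) 𝓘(ℝ, E') ∞ f) {x₀ : M}
    {v₀ : TangentSpace 𝓘(ℝ, E) x₀} (h₀ : mfderiv 𝓘(ℝ, E) 𝓘(ℝ, E') f x₀ v₀ ≠ 0) :
    ∃ l : ℝ, 0 < l ∧ (∀ x v, h'.pullbackNormSq f x v ≤ l * h.g.inner x v v) ∧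
      ∃ (p : M) (v : TangentSpace 𝓘(ℝ, E) p), v ≠ 0 ∧
        h'.pullbackNormSq f p v = l * h.g.inner p v v := by
  have hv₀ : v₀ ≠ 0 := by
    rintro rfl
    exact h₀ (map_zero _)
  obtain ⟨l, ⟨p, v, hv, hl⟩, hmax⟩ := (exists_isCompact_ratio h h' hf).exists_isGreatest
    ⟨_, x₀, v₀, hv₀, rfl⟩
  have hle (x : M) (v : TangentSpace 𝓘(ℝ, E) x) (hv : v ≠ 0) :
    h'.pullbackNormSq f x v / h.g.inner x v v ≤ l := hmax ⟨x, v, hv, rfl⟩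
  refine ⟨l, (div_pos (h'.g.pos _ _ h₀) (h.g.pos _ _ hv₀)).trans_le (hle x₀ v₀ hv₀), ?_,
    p, v, hv, (div_eq_iff (h.g.pos _ _ hv).ne').1 hl⟩
  intro x w
  rcases eq_or_ne w 0 with rfl | hw
  · simp [pullbackNormSq]
  · exact (div_le_iff₀ (h.g.pos _ _ hw)).1 (hle x w hw)

/-- Under the curvature hypotheses, the differential of an almost holomorphic map vanishes. -/
theorem IsAlmostHolomorphic.mfderiv_eq_zero [CompactSpace M] (hf : h.IsAlmostHolomorphic h' f)
    (hcurv : (h.HasNonnegHSC ∧ h'.HasNegHSC) ∨ (h.HasPosHSC ∧ h'.HasNonposHSC)) (x : M)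
    (v : TangentSpace 𝓘(ℝ, E) x) : mfderiv 𝓘(ℝ, E) 𝓘(ℝ, E') f x v = 0 := by
  by_contra h₀
  obtain ⟨l, hl, hmax, p, v, hv, heq⟩ := exists_max_pullbackNormSq h h' hf.1 h₀
  have key := curvature_le_of_isMax hf hmax heq
  have hgv := h.g.pos p v hv
  -- As `l > 0`, the maximizing vector has nonzero image, so the curvature hypothesis on the target
  -- applies to it.
  have hw : mfderiv 𝓘(ℝ, E) 𝓘(ℝ, E') f p v ≠ 0 := by
    intro h0
    rw [pullbackNormSq, h0, map_zero] at heq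
    exact (mul_pos hl hgv).ne heq
  have hgw := h'.g.pos (f p) _ hw
  rcases hcurv with ⟨h1, h2⟩ | ⟨h1, h2⟩
  · have a1 := h1 p v hv
    have a2 := h2 (f p) _ hw
    rw [holomorphicSectionalCurvature, le_div_iff₀ (pow_pos hgv 2), zero_mul] at a1
    rw [holomorphicSectionalCurvature, div_lt_iff₀ (pow_pos hgw 2), zero_mul] at a2
    exact absurd (mul_nonneg hl.le a1) (key.trans_lt a2).not_ge
  · have a1 := h1 p v hv
    have a2 := h2 (f p) _ hw
    rw [holomorphicSectionalCurvature, lt_div_iff₀ (pow_pos hgv 2), zero_mul] at a1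
    rw [holomorphicSectionalCurvature, div_le_iff₀ (pow_pos hgw 2), zero_mul] at a2
    exact absurd (mul_pos hl a1) (key.trans a2).not_gt

end AlmostHermitianStructure

/-! ### From vanishing differential to constancy -/

/-- A map whose differential vanishes is locally constant. -/
theorem TangentChart.isLocallyConstant_of_mfderiv_eq_zero
    {E : Type*} [NormedAddCommGroup E] [NormedSpace ℝ E]
    {M : Type*} [TopologicalSpace M] [ChartedSpace E M] [IsManifold 𝓘(ℝ, E) ∞ M]
    {E' : Type*} [NormedAddCommGroup E'] [NormedSpace ℝ E']
    {N : Type*} [TopologicalSpace N] [ChartedSpace E' N] [IsManifold 𝓘(ℝ, E') ∞ N] {f : M → N}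
    (hf : ContMDiff 𝓘(ℝ, E) 𝓘(ℝ, E') ∞ f)
    (h0 : ∀ x (v : TangentSpace 𝓘(ℝ, E) x), mfderiv 𝓘(ℝ, E) 𝓘(ℝ, E') f x v = 0) :
    IsLocallyConstant f := by
  refine (IsLocallyConstant.iff_eventually_eq f).2 fun p ↦ ?_
  have hU : IsOpen (chartMapDomain E E' f p (f p)) := isOpen_chartMapDomain hf.continuous
  have hp : extChartAt 𝓘(ℝ, E) p p ∈ chartMapDomain E E' f p (f p) := mem_chartMapDomain
  obtain ⟨ε, hε, hb⟩ := Metric.isOpen_iff.1 hU _ hp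
  have hF : ∀ z ∈ Metric.ball (extChartAt 𝓘(ℝ, E) p p) ε,
      chartMap f p (f p) z = chartMap f p (f p) (extChartAt 𝓘(ℝ, E) p p) := fun z hz ↦
    Metric.isOpen_ball.is_const_of_fderiv_eq_zero (𝕜 := ℝ)
      (convex_ball (extChartAt 𝓘(ℝ, E) p p) ε).isPreconnected
      (((contDiffOn_chartMap hf).differentiableOn (by simp)).mono hb) (fun y hy ↦ by
        ext a
        rw [fderiv_chartMap hf (hb hy), h0, map_zero]
        rfl) hz (Metric.mem_ball_self hε)
  filter_upwards [extChartAt_source_mem_nhds (I := 𝓘(ℝ, E)) p,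
    (continuousAt_extChartAt (I := 𝓘(ℝ, E)) p).preimage_mem_nhds (Metric.ball_mem_nhds _ hε)]
    with y hy hy'
  have e := congrArg (extChartAt 𝓘(ℝ, E') (f p)).symm (hF _ hy')
  rwa [symm_chartMap (hb hy'), symm_chartMap hp, (extChartAt 𝓘(ℝ, E) p).left_inv hy,
    extChartAt_to_inv] at e

theorem corollary1p6
    {E : Type*} [NormedAddCommGroup E] [NormedSpace ℝ E] [FiniteDimensional ℝ E]
    {M : Type*} [TopologicalSpace M] [T2Space M] [CompactSpace M] [ConnectedSpace M]
    [ChartedSpace E M] [IsManifold 𝓘(ℝ, E) ∞ M]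
    {E' : Type*} [NormedAddCommGroup E'] [NormedSpace ℝ E'] [FiniteDimensional ℝ E']
    {N : Type*} [TopologicalSpace N] [T2Space N]
    [ChartedSpace E' N] [IsManifold 𝓘(ℝ, E') ∞ N]
    (h : AlmostHermitianStructure E M) (h' : AlmostHermitianStructure E' N)
    (hcurv : (h.HasNonnegHSC ∧ h'.HasNegHSC) ∨ (h.HasPosHSC ∧ h'.HasNonposHSC))
    (f : M → N) (hf : h.IsAlmostHolomorphic h' f) :
    ∃ c : N, ∀ x : M, f x = c := by
  have hc := TangentChart.isLocallyConstant_of_mfderiv_eq_zero hf.1 (hf.mfderiv_eq_zero hcurv)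
  obtain ⟨x₀⟩ : Nonempty M := inferInstance
  exact ⟨f x₀, fun x ↦ hc.apply_eq_of_preconnectedSpace x x₀⟩
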